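/- **Theorem (Averaging the empirical measure).** *Potentials.* Let $\beta\in\mathbb R$, $s>1$. Let $\mathbf A_e\in L^2(\mathbb R^2;\mathbb R^2)\cap W^{2,\infty}(\mathbb R^2;\mathbb R^2)$ (continuous representative; then $|\mathbf A_e|^2\in W^{1,\infty}\cap L^2$). Let $V:\mathbb R^2\to[0,\infty)$ be differentiable with $V(x)\ge c|x|^s-C_0$ and $|\nabla V(x)|\le c'|x|^{s-1}+C_0'$ for some constants $c>0$, $C_0,c',C_0'$. Let $\chi:\mathbb R^2\to[0,\infty)$ be smooth, radial and nonincreasing in $|x|$, with $\chi=1/\pi^2$ for $|x|\le1$, $\chi=0$ for $|x|\ge2$ and $\int\chi=1$. For $R>0$ put $\chi_R=R^{-2}\chi(\cdot/R)$, $w_R=\log|\cdot|*\chi_R$ and $\nabla^\perp=(-\partial_2,\partial_1)$. For a finite measure $\mu$ on $\mathbb R^2\times\mathbb R^2$ with position marginal $\rho$ let $\mathbf A^R[\rho]=\nabla^\perp w_R*\rho$ and $$\mathcal E^R_V[\mu]=\int\big|p+\mathbf A_e(x)+\beta\,\mathbf A^R[\rho](x)\big|^2\,d\mu(x,p)+\int_{\mathbb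 R^2}V\,d\rho .$$ *Grid.* For $l_x,l_p>0$ divide $\mathbb R^4$ into the half-open boxes $\Omega_m$ of the grid with vertices in $(l_x\mathbb Z)^2\times(l_p\mathbb Z)^2$, of side $l_x$ in the two position coordinates and $l_p$ in the two momentum coordinates. Let $S_L=[-L,L]^4$ and $$\mathrm{Ave}[\mu]=\sum_{\Omega_m\subset S_L}\frac{\mu(\Omega_m)}{|\Omega_m|}\,\mathbf 1_{\Omega_m}.$$ For $Z=(z_1,\dots,z_N)\in(\mathbb R^4)^N$ let $\mathrm{Emp}_Z=\frac1N\sum_{i=1}^N\delta_{z_i}$, and let $\Gamma_\varepsilon$ be the set of those $\mathrm{Emp}_Z$ for which some box $\Omega_m\subset S_L$ satisfies $\mathrm{Emp}_Z(\Omega_m)\ge\frac{1+\varepsilon}{(2\pi)^2}|\Omega_m|$. *Claim.* There is a constant $C>0$, depending only on $\mathbf A_e,V,s,\chi,\beta$, such that the following holds. Let $0<b<1$, $\varepsilon>0$, and let $R=R_N$, $l_x=l_x(N)$, $l_p=l_p(N)$ be positive with $$l_x^2l_p^2=N^{-b},\qquad R\to0,\qquad l_x/R\to0,\qquad l_p\to0\qquad(N\to\infty).$$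 Then there are sequences $o^{(1)}_N\to0$ and $o^{(2)}_N\to0$ such that for all $N\ge1$, $L>0$, $D\in\mathbb R$, $Z\in(\mathbb R^4)^N$ with $\mathrm{Emp}_Z\notin\Gamma_\varepsilon$ and $$\int\big(|p|^2+V(x)\big)\,d\mathrm{Emp}_Z(x,p)\le D,$$ and for all $\sigma>0$, $$\mathcal E^R_V[\mathrm{Emp}_Z]\ \ge\ (1-\sigma)\big(1-o^{(1)}_N\big)\,\mathcal E^R_V\big[\mathrm{Ave}[\mathrm{Emp}_Z]\big]-o^{(2)}_N-C\,\frac{D^2}{\sigma R^2\min(L^4,L^{2s})}.$$ -/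

import Mathlib

open MeasureTheory Filter Topology
open scoped ENNReal NNReal ContDiff Convolution

noncomputable section

namespace Anyons

/-- The Euclidean plane. -/
abbrev Plane : Type := EuclideanSpace ℝ (Fin 2)

/-- The phase space of positions and momenta `z = (x, p)`. -/
abbrev Phase : Type := Plane × Plane

/-- Rotation by a right angle: `(v₁, v₂)^⊥ = (-v₂, v₁)`. -/
def perp (v : Plane) : Plane := !₂[-v 1, v 0]

/-- The standing assumption on the external potentials.  The vector potential `Ae` is (the continuous
representative of) an element of `L² ∩ W^{2,∞}`, that is, `Ae` is square integrable, bounded and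
differentiable with a bounded Lipschitz derivative; then `|Ae|²` is automatically in
`W^{1,∞} ∩ L²`.  The scalar potential `V` is nonnegative and differentiable, it grows at least like
`|x|^s`, and its gradient grows at most like `|x|^(s-1)`. -/
structure ExternalPotentials (Ae : Plane → Plane) (V : Plane → ℝ) (s : ℝ) : Prop where
  memLp_Ae : MemLp Ae 2 volume
  bounded_Ae : ∃ M : ℝ, ∀ x, ‖Ae x‖ ≤ M
  differentiable_Ae : Differentiable ℝ Ae
  bounded_fderiv_Ae : ∃ M : ℝ, ∀ x, ‖fderiv ℝ Ae x‖ ≤ M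
  lipschitz_fderiv_Ae : ∃ K : ℝ≥0, LipschitzWith K (fderiv ℝ Ae)
  one_lt_s : 1 < s
  differentiable_V : Differentiable ℝ V
  nonneg_V : ∀ x, 0 ≤ V x
  growth_V : ∃ c C : ℝ, 0 < c ∧ ∀ x, c * ‖x‖ ^ s - C ≤ V x
  growth_gradient_V : ∃ c C : ℝ, ∀ x, ‖gradient V x‖ ≤ c * ‖x‖ ^ (s - 1) + C

/-- The smearing profile `χ`: smooth, radial and nonincreasing in `|x|`, equal to `1/π²` for
`|x| ≤ 1` and to `0` for `|x| ≥ 2` (so it is nonnegative), of unit mass. -/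
structure SmearingProfile (χ : Plane → ℝ) : Prop where
  smooth : ContDiff ℝ ∞ χ
  eq_inside : ∀ x, ‖x‖ ≤ 1 → χ x = 1 / Real.pi ^ 2
  eq_outside : ∀ x, 2 ≤ ‖x‖ → χ x = 0
  radial_antitone : ∀ x y, ‖x‖ ≤ ‖y‖ → χ y ≤ χ x
  integral_eq_one : ∫ x, χ x = 1

/-- `χ_R = R⁻² χ(· / R)`. -/
def smear (χ : Plane → ℝ) (R : ℝ) (x : Plane) : ℝ := 1 / R ^ 2 * χ (R⁻¹ • x)

/-- The Coulomb potential of a smeared unit charge, `w_R = log|·| * χ_R`. -/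
def coulomb (χ : Plane → ℝ) (R : ℝ) : Plane → ℝ :=
  (fun x : Plane => Real.log ‖x‖) ⋆[ContinuousLinearMap.mul ℝ ℝ, volume] (smear χ R)

/-- `∇^⊥ w_R = (-∂₂ w_R, ∂₁ w_R)`. -/
def perpGrad (χ : Plane → ℝ) (R : ℝ) (x : Plane) : Plane := perp (gradient (coulomb χ R) x)

/-- The vector potential `A^R[ρ] = ∇^⊥ w_R * ρ` of a measure `ρ` on the plane. -/
def vectorPotential (χ : Plane → ℝ) (R : ℝ) (ρ : Measure Plane) (x : Plane) : Plane :=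
  ∫ y, perpGrad χ R (x - y) ∂ρ

/-- The regularized Vlasov energy
`E_V^R[μ] = ∫ |p + Ae(x) + β A^R[ρ](x)|² dμ(x, p) + ∫ V dρ`, where `ρ` is the position marginal
of `μ`. -/
def vlasovEnergy (Ae : Plane → Plane) (V : Plane → ℝ) (β : ℝ) (χ : Plane → ℝ) (R : ℝ)
    (μ : Measure Phase) : ℝ :=
  (∫ z, ‖z.2 + Ae z.1 + β • vectorPotential χ R μ.fst z.1‖ ^ 2 ∂μ) + ∫ x, V x ∂μ.fst

/-- The empirical measure `(1/N) ∑ δ_{z_i}` of a configuration of `N` points in phase space. -/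
def emp {N : ℕ} (Z : Fin N → Phase) : Measure Phase :=
  (N : ℝ≥0∞)⁻¹ • ∑ i, Measure.dirac (Z i)

/-- The boxes of the grid of phase space: side `lx` in the position coordinates and `lp` in the
momentum coordinates.  They are half-open, so that they form a partition of the phase space. -/
def box (lx lp : ℝ) (m : (Fin 2 → ℤ) × (Fin 2 → ℤ)) : Set Phase :=
  {z | (∀ i, m.1 i * lx ≤ z.1 i ∧ z.1 i < (m.1 i + 1) * lx) ∧
       (∀ i, m.2 i * lp ≤ z.2 i ∧ z.2 i < (m.2 i + 1) * lp)}

/-- The phase-space cube `S_L = [-L, L]⁴`. -/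
def cube (L : ℝ) : Set Phase := {z | (∀ i, |z.1 i| ≤ L) ∧ (∀ i, |z.2 i| ≤ L)}

/-- The density `∑_m 1_{Ω_m} μ(Ω_m) / |Ω_m|`, where the sum runs over the boxes `Ω_m ⊆ S_L`. -/
def aveDensity (lx lp L : ℝ) (μ : Measure Phase) (z : Phase) : ℝ≥0∞ :=
  ∑' m : {m // box lx lp m ⊆ cube L},
    (box lx lp m.1).indicator (fun _ => μ (box lx lp m.1) / volume (box lx lp m.1)) z

/-- The local average `Ave[μ]` with respect to the grid, as a measure on the phase space. -/
def ave (lx lp L : ℝ) (μ : Measure Phase) : Measure Phase :=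
  volume.withDensity (aveDensity lx lp L μ)

/-- The set `Γ_ε` of empirical measures of `N` points that violate the Pauli bound with factor
`1 + ε` in at least one box contained in `S_L`. -/
def pauliViolating (N : ℕ) (lx lp L ε : ℝ) : Set (Measure Phase) :=
  {μ | (∃ Z : Fin N → Phase, μ = emp Z) ∧
    ∃ m, box lx lp m ⊆ cube L ∧
      (1 + ε) / (2 * Real.pi) ^ 2 * volume.real (box lx lp m) ≤ μ.real (box lx lp m)}

end Anyons

end
/-!
Averaging over a box moves positions by at most `2 lx` and momenta by at most `2 lp`, and the
smeared field `∇^⊥ w_R` varies on the scale `R`: `|∇^⊥ w_R(x)| ≲ 1 / (R + |x|)` with gradient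
`≲ 1 / (R + |x|)²`. Hence the mechanical momentum of `Ave[μ]` differs from that of the restriction
of `μ` to the averaged region by `lp` plus `lx` times the convolution of `1 / (R + |·|)²` with the
position density of `Ave[μ]`. The Pauli bound `Ave[μ] ≤ M dx dp` makes the bathtub principle
available in the momentum variable: a position density can only be concentrated at the expense of
kinetic energy, so this convolution is bounded by `1 / R` times the square root of the kinetic
energy of `Ave[μ]`, and the error is absorbed into `E[Ave[μ]]`.

The particles outside the averaged region have mass `O(D / min(L², L^s))` by Chebyshev's inequality,
and each acts on the others through a field of size `O(1 / R)`; splitting a square with weights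
`1 - σ` and `σ⁻¹` turns this into the last error term. This needs `L` large. For bounded `L` the
Pauli bound gives `E[Ave[μ]] ≲ Ave[μ](1)`, and the bathtub principle bounds this mass by
`√R + lp + √R D² / R²`, whose last summand is dominated by the same error term.
-/

noncomputable section

namespace Anyons

section LogNorm

variable {E : Type*} [NormedAddCommGroup E]

theorem abs_log_le_inv_add_self {y : ℝ} (hy : 0 ≤ y) : |Real.log y| ≤ y⁻¹ + y := by
  rcases hy.eq_or_lt with rfl | hy
  · simp
  have h₁ := Real.log_le_sub_one_of_pos hy
  have h₂ := Real.log_le_sub_one_of_pos (inv_pos.2 hy)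
  rw [Real.log_inv] at h₂
  have := inv_pos.2 hy
  exact abs_le.2 ⟨by linarith, by linarith⟩

theorem locallyIntegrable_inv_norm [NormedSpace ℝ E] [FiniteDimensional ℝ E] [MeasurableSpace E]
    [BorelSpace E] {μ : Measure E} [μ.IsAddHaarMeasure] (hE : 1 < Module.finrank ℝ E) :
    LocallyIntegrable (fun x : E => ‖x‖⁻¹) μ :=
  locallyIntegrable_of_norm_le_rpow (C := 1) (α := 1) hE.le (by exact_mod_cast hE)
    (.of_forall fun x => by simp [Real.rpow_neg_one]) (by fun_prop)

theorem locallyIntegrable_log_norm [NormedSpace ℝ E] [FiniteDimensional ℝ E] [MeasurableSpace E]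
    [BorelSpace E] {μ : Measure E} [μ.IsAddHaarMeasure] (hE : 1 < Module.finrank ℝ E) :
    LocallyIntegrable (fun x : E => Real.log ‖x‖) μ :=
  ((locallyIntegrable_inv_norm hE).add continuous_norm.locallyIntegrable).mono
    (Real.measurable_log.comp measurable_norm).aestronglyMeasurable
    (.of_forall fun x => (abs_log_le_inv_add_self (norm_nonneg x)).trans (le_abs_self _))

theorem half_norm_le_norm_sub {x t : E} (ht : 2 * ‖t‖ ≤ ‖x‖) : ‖x‖ / 2 ≤ ‖x - t‖ := by
  linarith [norm_sub_norm_le x t]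

theorem abs_log_norm_sub_sub_log_norm_le {x t : E} (hx : x ≠ 0) (ht : 2 * ‖t‖ ≤ ‖x‖) :
    |Real.log ‖x - t‖ - Real.log ‖x‖| ≤ 2 * ‖t‖ / ‖x‖ := by
  have hx₀ : 0 < ‖x‖ := norm_pos_iff.2 hx
  have hxt := half_norm_le_norm_sub ht
  have hxt₀ : 0 < ‖x - t‖ := by linarith
  have upper := Real.log_le_sub_one_of_pos (div_pos hxt₀ hx₀)
  have lower := Real.log_le_sub_one_of_pos (div_pos hx₀ hxt₀)
  rw [Real.log_div hxt₀.ne' hx₀.ne'] at upper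
  rw [Real.log_div hx₀.ne' hxt₀.ne'] at lower
  have h₁ : ‖x - t‖ / ‖x‖ - 1 ≤ 2 * ‖t‖ / ‖x‖ := by
    rw [div_sub_one hx₀.ne']
    gcongr
    linarith [norm_sub_le x t, norm_nonneg t]
  have h₂ : ‖x‖ / ‖x - t‖ - 1 ≤ 2 * ‖t‖ / ‖x‖ := by
    rw [div_sub_one hxt₀.ne', div_le_div_iff₀ hxt₀ hx₀]
    calc (‖x‖ - ‖x - t‖) * ‖x‖ ≤ ‖t‖ * (2 * ‖x - t‖) := by
          gcongr
          · linarith [norm_sub_norm_le x (x - t), congrArg norm (sub_sub_cancel x t)]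
          · linarith
      _ = 2 * ‖t‖ * ‖x - t‖ := by ring
  exact abs_le.2 ⟨by linarith, by linarith⟩

variable [InnerProductSpace ℝ E]

theorem hasFDerivAt_log_norm {x : E} (hx : x ≠ 0) :
    HasFDerivAt (fun y : E => Real.log ‖y‖) (innerSL ℝ (EuclideanGeometry.inversion 0 1 x)) x := by
  have h : HasFDerivAt (fun y : E => Real.log (‖y‖ ^ 2)) ((‖x‖ ^ 2)⁻¹ • (2 • innerSL ℝ x)) x :=
    (hasStrictFDerivAt_norm_sq x).hasFDerivAt.log (by simpa using hx)
  have e : (fun y : E => Real.log ‖y‖) = fun y => 1 / 2 * Real.log (‖y‖ ^ 2) := by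
    funext y
    rw [Real.log_pow]
    push_cast
    ring
  rw [e]
  refine (h.const_mul (1 / 2 : ℝ)).congr_fderiv ?_
  ext v
  simp [EuclideanGeometry.inversion]
  ring

theorem norm_inversion_zero_one_sub {x y : E} (hx : x ≠ 0) (hy : y ≠ 0) :
    ‖EuclideanGeometry.inversion 0 1 x - EuclideanGeometry.inversion 0 1 y‖
      = ‖x - y‖ / (‖x‖ * ‖y‖) := by
  have h := EuclideanGeometry.dist_inversion_inversion hx hy 1
  rw [dist_zero_right, dist_zero_right, dist_eq_norm, dist_eq_norm, one_pow] at h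
  rw [h, one_div_mul_eq_div]

theorem abs_log_norm_sub_sub_log_norm_sub_le {x x' t : E} (hx : x ≠ 0) (ht : 2 * ‖t‖ ≤ ‖x‖)
    (hxx' : 4 * ‖x - x'‖ ≤ ‖x‖) :
    |(Real.log ‖x - t‖ - Real.log ‖x' - t‖) - (Real.log ‖x‖ - Real.log ‖x'‖)|
      ≤ 8 * ‖x - x'‖ / ‖x‖ ^ 2 * ‖t‖ := by
  have hx₀ : 0 < ‖x‖ := norm_pos_iff.2 hx
  have away {s : E} (hs : s ∈ Metric.closedBall 0 ‖t‖) :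
      ‖x‖ / 2 ≤ ‖x - s‖ ∧ ‖x‖ / 4 ≤ ‖x' - s‖ := by
    have hs : ‖s‖ ≤ ‖t‖ := by simpa using hs
    have h₁ := half_norm_le_norm_sub (x := x) (t := s) (by linarith)
    have h₂ := norm_sub_norm_le (x - s) (x - x')
    rw [sub_sub_sub_cancel_left] at h₂
    exact ⟨h₁, by linarith⟩
  have ne_zero {s : E} (hs : s ∈ Metric.closedBall 0 ‖t‖) : x - s ≠ 0 ∧ x' - s ≠ 0 :=
    ⟨norm_pos_iff.1 (by linarith [(away hs).1]), norm_pos_iff.1 (by linarith [(away hs).2])⟩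
  have key := Convex.norm_image_sub_le_of_norm_hasFDerivWithin_le (𝕜 := ℝ)
    (f := fun s : E => Real.log ‖x - s‖ - Real.log ‖x' - s‖) (s := Metric.closedBall 0 ‖t‖)
    (x := 0) (y := t) (C := 8 * ‖x - x'‖ / ‖x‖ ^ 2)
    (f' := fun s => (innerSL ℝ (EuclideanGeometry.inversion 0 1 (x - s)
        - EuclideanGeometry.inversion 0 1 (x' - s))).comp (-ContinuousLinearMap.id ℝ E))
    (fun s hs => ?_) (fun s hs => ?_) (convex_closedBall _ _) (by simp) (by simp)
  · simpa using key
  · rw [map_sub, ContinuousLinearMap.sub_comp]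
    exact (((hasFDerivAt_log_norm (ne_zero hs).1).comp s ((hasFDerivAt_id s).const_sub x)).sub
      ((hasFDerivAt_log_norm (ne_zero hs).2).comp s
        ((hasFDerivAt_id s).const_sub x'))).hasFDerivWithinAt
  · rw [ContinuousLinearMap.comp_neg, norm_neg, ContinuousLinearMap.comp_id, innerSL_apply_norm,
      norm_inversion_zero_one_sub (ne_zero hs).1 (ne_zero hs).2, sub_sub_sub_cancel_right]
    have h : ‖x‖ / 2 * (‖x‖ / 4) ≤ ‖x - s‖ * ‖x' - s‖ := by
      gcongr
      exacts [(away hs).1, (away hs).2]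
    calc ‖x - x'‖ / (‖x - s‖ * ‖x' - s‖) ≤ ‖x - x'‖ / (‖x‖ / 2 * (‖x‖ / 4)) := by gcongr
      _ = 8 * ‖x - x'‖ / ‖x‖ ^ 2 := by field_simp; ring

end LogNorm

section CompactSupport

variable {E : Type*} [NormedAddCommGroup E] [NormedSpace ℝ E] [MeasurableSpace E] [BorelSpace E]
  {μ : Measure E} {f : E → ℝ}

theorem integrable_fderiv_of_hasCompactSupport [IsFiniteMeasureOnCompacts μ] (hf : ContDiff ℝ 1 f)
    (hc : HasCompactSupport f) :
    Integrable (fderiv ℝ f) μ :=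
  (hf.continuous_fderiv one_ne_zero).integrable_of_hasCompactSupport (hc.fderiv ℝ)

variable [FiniteDimensional ℝ E] [μ.IsAddHaarMeasure]

theorem integral_fderiv_apply_eq_zero (hf : ContDiff ℝ 1 f) (hc : HasCompactSupport f) (v : E) :
    ∫ t, fderiv ℝ f t v ∂μ = 0 := by
  have hi : Integrable (fun t => fderiv ℝ f t v) μ :=
    (integrable_fderiv_of_hasCompactSupport hf hc).apply_continuousLinearMap v
  simpa using integral_mul_fderiv_eq_neg_fderiv_mul_of_integrable (μ := μ) (v := v)
    (f := fun _ : E => (1 : ℝ)) (g := f) (by simp) (by simpa using hi)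
    (by simpa using hf.continuous.integrable_of_hasCompactSupport hc) (by simp)
    (fun t _ => hf.differentiable one_ne_zero t)

theorem abs_integral_mul_fderiv_apply_le (hf : ContDiff ℝ 1 f) (hc : HasCompactSupport f) (v : E)
    {H : E → ℝ} (hi : Integrable (fun t => H t * fderiv ℝ f t v) μ) {a c : ℝ}
    (hH : ∀ t ∈ tsupport f, |H t - a| ≤ c) :
    |∫ t, H t * fderiv ℝ f t v ∂μ| ≤ c * (∫ t, ‖fderiv ℝ f t‖ ∂μ) * ‖v‖ := by
  have hi' : Integrable (fun t => fderiv ℝ f t v) μ :=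
    (integrable_fderiv_of_hasCompactSupport hf hc).apply_continuousLinearMap v
  have subtract_const :
      ∫ t, H t * fderiv ℝ f t v ∂μ = ∫ t, (H t - a) * fderiv ℝ f t v ∂μ := by
    simp_rw [sub_mul]
    rw [integral_sub hi (hi'.const_mul _), integral_const_mul,
      integral_fderiv_apply_eq_zero hf hc, mul_zero, sub_zero]
  rw [subtract_const, ← Real.norm_eq_abs, ← integral_const_mul, ← integral_mul_const]
  refine norm_integral_le_of_norm_le
    (((integrable_fderiv_of_hasCompactSupport hf hc).norm.const_mul c).mul_const _)
    (.of_forall fun t => ?_)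
  rw [norm_mul, mul_assoc]
  by_cases ht : t ∈ tsupport f
  · exact mul_le_mul (hH t ht) ((fderiv ℝ f t).le_opNorm v) (norm_nonneg _)
      ((abs_nonneg _).trans (hH t ht))
  · have : fderiv ℝ f t = 0 := by
      by_contra h
      exact ht (support_fderiv_subset ℝ h)
    simp [this]

end CompactSupport

theorem one_lt_finrank_plane : 1 < Module.finrank ℝ Plane := by simp

/-- The rotation `perp` as a linear isometry, which makes available its linearity, continuity and
norm preservation. -/
def perpLinearIsometry : Plane →ₗᵢ[ℝ] Plane where
  toFun := perp
  map_add' v w := by ext i; fin_cases i <;> simp [perp, add_comm]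
  map_smul' c v := by ext i; fin_cases i <;> simp [perp]
  norm_map' v := by simp [perp, EuclideanSpace.norm_eq, add_comm]

theorem coulomb_one (χ : Plane → ℝ) :
    coulomb χ 1 = (fun x : Plane => Real.log ‖x‖) ⋆[ContinuousLinearMap.mul ℝ ℝ, volume] χ := by
  have : smear χ 1 = χ := by funext x; simp [smear]
  rw [coulomb, this]

theorem perpGrad_eq (χ : Plane → ℝ) (R : ℝ) (x : Plane) :
    perpGrad χ R x
      = perpLinearIsometry ((InnerProductSpace.toDual ℝ Plane).symm (fderiv ℝ (coulomb χ R) x)) :=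
  rfl

namespace SmearingProfile

variable {χ : Plane → ℝ} (hχ : SmearingProfile χ)

include hχ

theorem contDiff_one : ContDiff ℝ 1 χ := hχ.smooth.of_le (by simp)

theorem tsupport_subset : tsupport χ ⊆ Metric.closedBall 0 2 := by
  refine closure_minimal (fun x hx => ?_) Metric.isClosed_closedBall
  by_contra h
  exact hx (hχ.eq_outside x (by simpa using (lt_of_not_ge (mt mem_closedBall_zero_iff.2 h)).le))

theorem hasCompactSupport : HasCompactSupport χ :=
  (isCompact_closedBall 0 2).of_isClosed_subset (isClosed_tsupport χ) hχ.tsupport_subset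

theorem contDiff_coulomb_one : ContDiff ℝ ∞ (coulomb χ 1) := by
  rw [coulomb_one]
  exact hχ.hasCompactSupport.contDiff_convolution_right _
    (locallyIntegrable_log_norm one_lt_finrank_plane) hχ.smooth

theorem fderiv_coulomb_one_apply (x v : Plane) :
    fderiv ℝ (coulomb χ 1) x v = ∫ t, Real.log ‖x - t‖ * fderiv ℝ χ t v := by
  have hlog := locallyIntegrable_log_norm (μ := (volume : Measure Plane)) one_lt_finrank_plane
  have h := hχ.hasCompactSupport.hasFDerivAt_convolution_right (ContinuousLinearMap.mul ℝ ℝ)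
    hlog hχ.contDiff_one x
  rw [coulomb_one, h.fderiv, convolution_precompR_apply _ hlog (hχ.hasCompactSupport.fderiv ℝ)
    (hχ.contDiff_one.continuous_fderiv one_ne_zero), convolution_eq_swap]
  rfl

theorem integrable_log_norm_sub_mul_fderiv (x v : Plane) :
    Integrable (fun t => Real.log ‖x - t‖ * fderiv ℝ χ t v) := by
  have h := (hχ.hasCompactSupport.fderiv_apply ℝ v).convolutionExists_right
    (ContinuousLinearMap.mul ℝ ℝ) (locallyIntegrable_log_norm (μ := volume) one_lt_finrank_plane)
    ((hχ.contDiff_one.continuous_fderiv one_ne_zero).clm_apply continuous_const) x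
  simpa using h.integrable_swap

theorem norm_fderiv_coulomb_one_le_of_four_le {x : Plane} (hx : 4 ≤ ‖x‖) :
    ‖fderiv ℝ (coulomb χ 1) x‖ ≤ 4 / ‖x‖ * ∫ t, ‖fderiv ℝ χ t‖ := by
  refine ContinuousLinearMap.opNorm_le_bound _ (by positivity) fun v => ?_
  rw [hχ.fderiv_coulomb_one_apply]
  refine abs_integral_mul_fderiv_apply_le hχ.contDiff_one hχ.hasCompactSupport v
    (hχ.integrable_log_norm_sub_mul_fderiv x v) (a := Real.log ‖x‖) fun t ht => ?_
  have ht : ‖t‖ ≤ 2 := by simpa using hχ.tsupport_subset ht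
  calc _ ≤ 2 * ‖t‖ / ‖x‖ :=
        abs_log_norm_sub_sub_log_norm_le (norm_pos_iff.1 (by linarith)) (by linarith)
    _ ≤ 4 / ‖x‖ := by gcongr; linarith

theorem norm_fderiv_coulomb_one_sub_le_of_four_le {x x' : Plane} (hx : 4 ≤ ‖x‖)
    (hxx' : ‖x - x'‖ ≤ 1) :
    ‖fderiv ℝ (coulomb χ 1) x - fderiv ℝ (coulomb χ 1) x'‖
      ≤ 16 * ‖x - x'‖ / ‖x‖ ^ 2 * ∫ t, ‖fderiv ℝ χ t‖ := by
  refine ContinuousLinearMap.opNorm_le_bound _ (by positivity) fun v => ?_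
  have hi := (hχ.integrable_log_norm_sub_mul_fderiv x v).sub
    (hχ.integrable_log_norm_sub_mul_fderiv x' v)
  rw [sub_apply, hχ.fderiv_coulomb_one_apply, hχ.fderiv_coulomb_one_apply,
    ← integral_sub (hχ.integrable_log_norm_sub_mul_fderiv x v)
      (hχ.integrable_log_norm_sub_mul_fderiv x' v)]
  simp only [Pi.sub_def, ← sub_mul] at hi ⊢
  refine abs_integral_mul_fderiv_apply_le hχ.contDiff_one hχ.hasCompactSupport v hi
    (a := Real.log ‖x‖ - Real.log ‖x'‖) fun t ht => ?_
  have ht : ‖t‖ ≤ 2 := by simpa using hχ.tsupport_subset ht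
  calc _ ≤ 8 * ‖x - x'‖ / ‖x‖ ^ 2 * ‖t‖ := abs_log_norm_sub_sub_log_norm_sub_le
        (norm_pos_iff.1 (by linarith)) (by linarith) (by linarith)
    _ ≤ 8 * ‖x - x'‖ / ‖x‖ ^ 2 * 2 := by gcongr
    _ = 16 * ‖x - x'‖ / ‖x‖ ^ 2 := by ring

theorem exists_norm_fderiv_coulomb_one_le :
    ∃ C, ∀ x, ‖fderiv ℝ (coulomb χ 1) x‖ ≤ C / (1 + ‖x‖) := by
  obtain ⟨C, hC⟩ := (isCompact_closedBall (0 : Plane) 4).exists_bound_of_continuousOn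
    (hχ.contDiff_coulomb_one.continuous_fderiv (by simp)).continuousOn
  have hC₀ : 0 ≤ C := (norm_nonneg _).trans (hC 0 (by simp))
  have hI : 0 ≤ ∫ t, ‖fderiv ℝ χ t‖ := by positivity
  refine ⟨5 * C + 8 * ∫ t, ‖fderiv ℝ χ t‖, fun x => ?_⟩
  rw [le_div_iff₀ (by positivity)]
  rcases le_total 4 ‖x‖ with hx | hx
  · calc _ ≤ 4 / ‖x‖ * (∫ t, ‖fderiv ℝ χ t‖) * (2 * ‖x‖) := by
          gcongr
          exacts [hχ.norm_fderiv_coulomb_one_le_of_four_le hx, by linarith]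
      _ = 8 * ∫ t, ‖fderiv ℝ χ t‖ := by field_simp; ring
      _ ≤ _ := by linarith
  · calc _ ≤ C * 5 := by
          gcongr
          exacts [hC x (by simpa using hx), by linarith]
      _ ≤ _ := by linarith

theorem exists_norm_fderiv_coulomb_one_sub_le :
    ∃ C, ∀ x x', ‖x - x'‖ ≤ 1 →
      ‖fderiv ℝ (coulomb χ 1) x - fderiv ℝ (coulomb χ 1) x'‖ ≤ C * ‖x - x'‖ / (1 + ‖x‖) ^ 2 := by
  have hd : ContDiff ℝ 1 (fderiv ℝ (coulomb χ 1)) :=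
    hχ.contDiff_coulomb_one.fderiv_right (by norm_cast)
  obtain ⟨C, hC⟩ := (isCompact_closedBall (0 : Plane) 5).exists_bound_of_continuousOn
    (hd.continuous_fderiv one_ne_zero).continuousOn
  have hC₀ : 0 ≤ C := (norm_nonneg _).trans (hC 0 (by simp))
  have hI : 0 ≤ ∫ t, ‖fderiv ℝ χ t‖ := by positivity
  refine ⟨25 * C + 64 * ∫ t, ‖fderiv ℝ χ t‖, fun x x' hxx' => ?_⟩
  rw [le_div_iff₀ (by positivity)]
  rcases le_total 4 ‖x‖ with hx | hx
  · calc _ ≤ 16 * ‖x - x'‖ / ‖x‖ ^ 2 * (∫ t, ‖fderiv ℝ χ t‖) * (2 * ‖x‖) ^ 2 := by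
          gcongr
          exacts [hχ.norm_fderiv_coulomb_one_sub_le_of_four_le hx hxx', by linarith]
      _ = 64 * (∫ t, ‖fderiv ℝ χ t‖) * ‖x - x'‖ := by field_simp; ring
      _ ≤ _ := by gcongr; linarith
  · have mean_value := Convex.norm_image_sub_le_of_norm_fderiv_le (𝕜 := ℝ)
      (f := fderiv ℝ (coulomb χ 1)) (s := Metric.closedBall 0 5) (x := x') (y := x)
      (fun y _ => hd.differentiable one_ne_zero y) hC (convex_closedBall _ _)
      (by simp; linarith [norm_sub_norm_le x' x, norm_sub_rev x x']) (by simp; linarith)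
    calc _ ≤ C * ‖x - x'‖ * 5 ^ 2 := by gcongr; linarith
      _ = 25 * C * ‖x - x'‖ := by ring
      _ ≤ _ := by gcongr; linarith

theorem coulomb_eq {R : ℝ} (hR : 0 < R) (x : Plane) :
    coulomb χ R x = Real.log R + coulomb χ 1 (R⁻¹ • x) := by
  have hlogχ : Integrable (fun t => Real.log ‖t‖ * χ (R⁻¹ • x - t)) := by
    have h := hχ.hasCompactSupport.convolutionExists_right (ContinuousLinearMap.mul ℝ ℝ)
      (locallyIntegrable_log_norm (μ := volume) one_lt_finrank_plane) hχ.smooth.continuous (R⁻¹ • x)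
    simpa [ConvolutionExistsAt] using h
  have hχi : Integrable (fun t => χ (R⁻¹ • x - t)) :=
    (hχ.smooth.continuous.integrable_of_hasCompactSupport hχ.hasCompactSupport).comp_sub_left _
  have scaled : ∀ᵐ t : Plane, R ^ 2 * (Real.log ‖R • t‖ * smear χ R (x - R • t))
      = Real.log R * χ (R⁻¹ • x - t) + Real.log ‖t‖ * χ (R⁻¹ • x - t) := by
    filter_upwards [Measure.ae_ne volume (0 : Plane)] with t ht
    rw [smear, smul_sub, inv_smul_smul₀ hR.ne', norm_smul, Real.norm_of_nonneg hR.le,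
      Real.log_mul hR.ne' (norm_ne_zero_iff.2 ht)]
    field_simp
  have change_variables := Measure.integral_comp_smul (volume : Measure Plane)
    (fun t => Real.log ‖t‖ * smear χ R (x - t)) R
  rw [finrank_euclideanSpace_fin, abs_of_pos (by positivity), smul_eq_mul,
    eq_inv_mul_iff_mul_eq₀ (by positivity), ← integral_const_mul, integral_congr_ae scaled,
    integral_add (hχi.const_mul _) hlogχ, integral_const_mul,
    integral_sub_left_eq_self χ volume, hχ.integral_eq_one, mul_one] at change_variables
  rw [coulomb_one]
  exact change_variables.symm

theorem fderiv_coulomb {R : ℝ} (hR : 0 < R) (x : Plane) :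
    fderiv ℝ (coulomb χ R) x = R⁻¹ • fderiv ℝ (coulomb χ 1) (R⁻¹ • x) := by
  rw [funext (hχ.coulomb_eq hR), fderiv_const_add, fderiv_comp_smul]

theorem norm_perpGrad {R : ℝ} (hR : 0 < R) (x : Plane) :
    ‖perpGrad χ R x‖ = R⁻¹ * ‖fderiv ℝ (coulomb χ 1) (R⁻¹ • x)‖ := by
  rw [perpGrad_eq, LinearIsometry.norm_map, LinearIsometryEquiv.norm_map, hχ.fderiv_coulomb hR,
    norm_smul, Real.norm_of_nonneg (by positivity)]

theorem norm_perpGrad_sub {R : ℝ} (hR : 0 < R) (x x' : Plane) :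
    ‖perpGrad χ R x - perpGrad χ R x'‖
      = R⁻¹ * ‖fderiv ℝ (coulomb χ 1) (R⁻¹ • x) - fderiv ℝ (coulomb χ 1) (R⁻¹ • x')‖ := by
  rw [perpGrad_eq, perpGrad_eq, ← map_sub, ← map_sub, LinearIsometry.norm_map,
    LinearIsometryEquiv.norm_map, hχ.fderiv_coulomb hR, hχ.fderiv_coulomb hR, ← smul_sub,
    norm_smul, Real.norm_of_nonneg (by positivity)]

theorem continuous_perpGrad {R : ℝ} (hR : 0 < R) : Continuous (perpGrad χ R) := by
  refine perpLinearIsometry.continuous.comp ((LinearIsometryEquiv.continuous _).comp ?_)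
  have := hχ.contDiff_coulomb_one.continuous_fderiv (by simp)
  rw [funext (hχ.fderiv_coulomb hR)]
  fun_prop

theorem exists_norm_perpGrad_le :
    ∃ C, 0 < C ∧ ∀ R, 0 < R → ∀ x, ‖perpGrad χ R x‖ ≤ C / (R + ‖x‖) := by
  obtain ⟨C, hC⟩ := hχ.exists_norm_fderiv_coulomb_one_le
  refine ⟨max C 1, by positivity, fun R hR x => ?_⟩
  calc ‖perpGrad χ R x‖ = R⁻¹ * ‖fderiv ℝ (coulomb χ 1) (R⁻¹ • x)‖ := hχ.norm_perpGrad hR x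
    _ ≤ R⁻¹ * (max C 1 / (1 + ‖R⁻¹ • x‖)) := by
        gcongr
        exact (hC _).trans (by gcongr; exact le_max_left _ _)
    _ = max C 1 / (R + ‖x‖) := by
        rw [norm_smul, Real.norm_of_nonneg (by positivity)]
        field_simp

theorem exists_norm_perpGrad_sub_le :
    ∃ C, 0 < C ∧ ∀ R, 0 < R → ∀ x x', ‖x - x'‖ ≤ R →
      ‖perpGrad χ R x - perpGrad χ R x'‖ ≤ C * ‖x - x'‖ / (R + ‖x‖) ^ 2 := by
  obtain ⟨C, hC⟩ := hχ.exists_norm_fderiv_coulomb_one_sub_le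
  refine ⟨max C 1, by positivity, fun R hR x x' hxx' => ?_⟩
  have e : ‖R⁻¹ • x - R⁻¹ • x'‖ = R⁻¹ * ‖x - x'‖ := by
    rw [← smul_sub, norm_smul, Real.norm_of_nonneg (by positivity)]
  calc ‖perpGrad χ R x - perpGrad χ R x'‖
      = R⁻¹ * ‖fderiv ℝ (coulomb χ 1) (R⁻¹ • x) - fderiv ℝ (coulomb χ 1) (R⁻¹ • x')‖ :=
        hχ.norm_perpGrad_sub hR x x'
    _ ≤ R⁻¹ * (max C 1 * ‖R⁻¹ • x - R⁻¹ • x'‖ / (1 + ‖R⁻¹ • x‖) ^ 2) := by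
        gcongr
        refine (hC _ _ ?_).trans (by gcongr; exact le_max_left _ _)
        rw [e]
        exact inv_mul_le_one_of_le₀ hxx' hR.le
    _ = max C 1 * ‖x - x'‖ / (R + ‖x‖) ^ 2 := by
        rw [e, norm_smul, Real.norm_of_nonneg (by positivity)]
        field_simp

end SmearingProfile

section Blocks

variable {α ι : Type*} [MeasurableSpace α] [Countable ι] {B : ι → Set α} {μ ν : Measure α}

theorem setIntegral_iUnion_le_of_measure_eq (hm : ∀ i, MeasurableSet (B i))
    (hd : Pairwise (Function.onFun Disjoint B)) (hB : ∀ i, μ (B i) = ν (B i))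
    (hfin : ∀ i, μ (B i) ≠ ⊤) {f g : α → ℝ} (hf : IntegrableOn f (⋃ i, B i) μ)
    (hg : IntegrableOn g (⋃ i, B i) ν) (h : ∀ i, ∀ z ∈ B i, ∀ z' ∈ B i, f z ≤ g z') :
    ∫ z in ⋃ i, B i, f z ∂μ ≤ ∫ z in ⋃ i, B i, g z ∂ν := by
  refine hasSum_le (fun i => ?_) (hasSum_integral_iUnion hm hd hf)
    (hasSum_integral_iUnion hm hd hg)
  have hfi := hf.mono_set (Set.subset_iUnion B i)
  have hgi := hg.mono_set (Set.subset_iUnion B i)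
  rcases (B i).eq_empty_or_nonempty with he | ⟨z₀, hz₀⟩
  · simp [he]
  have hb : BddAbove (f '' B i) := ⟨g z₀, by rintro _ ⟨z, hz, rfl⟩; exact h i z hz z₀ hz₀⟩
  calc ∫ z in B i, f z ∂μ ≤ ∫ _ in B i, sSup (f '' B i) ∂μ :=
        setIntegral_mono_on hfi (integrableOn_const (hfin i)) (hm i)
          fun z hz => le_csSup hb ⟨z, hz, rfl⟩
    _ = ∫ _ in B i, sSup (f '' B i) ∂ν := by
        rw [setIntegral_const, setIntegral_const, measureReal_def, measureReal_def, hB i]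
    _ ≤ ∫ z in B i, g z ∂ν :=
        setIntegral_mono_on (integrableOn_const (hB i ▸ hfin i)) hgi (hm i) fun z' hz' =>
          csSup_le ⟨f z₀, z₀, hz₀, rfl⟩ (by rintro _ ⟨z, hz, rfl⟩; exact h i z hz z' hz')

theorem norm_setIntegral_iUnion_sub_le_of_measure_eq {E : Type*} [NormedAddCommGroup E]
    [InnerProductSpace ℝ E] [CompleteSpace E] (hm : ∀ i, MeasurableSet (B i))
    (hd : Pairwise (Function.onFun Disjoint B)) (hB : ∀ i, μ (B i) = ν (B i))
    (hfin : ∀ i, μ (B i) ≠ ⊤) {F F' : α → E} {G : α → ℝ} (hF : IntegrableOn F (⋃ i, B i) μ)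
    (hF' : IntegrableOn F' (⋃ i, B i) ν) (hG : IntegrableOn G (⋃ i, B i) ν)
    (h : ∀ i, ∀ z ∈ B i, ∀ z' ∈ B i, ‖F z - F' z'‖ ≤ G z') :
    ‖∫ z in ⋃ i, B i, F z ∂μ - ∫ z in ⋃ i, B i, F' z ∂ν‖ ≤ ∫ z in ⋃ i, B i, G z ∂ν := by
  obtain ⟨v, hv⟩ : ∃ v, v = ∫ z in ⋃ i, B i, F z ∂μ - ∫ z in ⋃ i, B i, F' z ∂ν := ⟨_, rfl⟩
  have hG₀ : 0 ≤ ∫ z in ⋃ i, B i, G z ∂ν := by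
    refine setIntegral_nonneg (.iUnion hm) fun z hz => ?_
    obtain ⟨i, hi⟩ := Set.mem_iUnion.1 hz
    exact (norm_nonneg _).trans (h i z hi z hi)
  have pointwise (i) (z) (hz : z ∈ B i) (z') (hz' : z' ∈ B i) :
      inner ℝ v (F z) ≤ inner ℝ v (F' z') + ‖v‖ * G z' := by
    have : inner ℝ v (F z - F' z') ≤ ‖v‖ * G z' :=
      (real_inner_le_norm _ _).trans (mul_le_mul_of_nonneg_left (h i z hz z' hz') (norm_nonneg _))
    rw [inner_sub_right] at this
    linarith
  have key := setIntegral_iUnion_le_of_measure_eq hm hd hB hfin (hF.const_inner v)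
    ((hF'.const_inner v).add (hG.const_mul _)) pointwise
  simp only [Pi.add_apply] at key
  rw [integral_add (hF'.const_inner v) (hG.const_mul _), integral_inner hF, integral_inner hF',
    integral_const_mul, ← sub_le_iff_le_add', ← inner_sub_right, ← hv,
    real_inner_self_eq_norm_mul_norm] at key
  rw [← hv]
  rcases (norm_nonneg v).eq_or_lt with hv₀ | hv₀
  · rwa [← hv₀]
  · exact le_of_mul_le_mul_left key hv₀

end Blocks

section Bathtub

variable {X : Type*} [MeasurableSpace X] {m : Measure X} {a : X → Plane} {G : X → ℝ}
  {t : ℝ} {ν : Measure (X × Plane)} {M : ℝ≥0}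

theorem lintegral_indicator_norm_add_sq_lt (ha : Measurable a) (hG : Measurable G)
    (hG₀ : ∀ x, 0 ≤ G x) (ht : 0 < t) :
    ∫⁻ z, {z : X × Plane | ‖z.2 + a z.1‖ ^ 2 < t * G z.1}.indicator
        (fun z => ENNReal.ofReal (G z.1)) z ∂(m.prod volume)
      = ENNReal.ofReal (Real.pi * t) * ∫⁻ x, ENNReal.ofReal (G x ^ 2) ∂m := by
  have hS : MeasurableSet {z : X × Plane | ‖z.2 + a z.1‖ ^ 2 < t * G z.1} :=
    measurableSet_lt (by fun_prop) (by fun_prop)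
  have section_eq (x : X) (p : Plane) :
      {z : X × Plane | ‖z.2 + a z.1‖ ^ 2 < t * G z.1}.indicator
        (fun z => ENNReal.ofReal (G z.1)) (x, p)
      = (Metric.ball (-a x) √(t * G x)).indicator (fun _ => ENNReal.ofReal (G x)) p := by
    refine Set.indicator_eq_indicator ?_ rfl
    rw [mem_ball_iff_norm, sub_neg_eq_add, Real.lt_sqrt (norm_nonneg _)]
    rfl
  rw [lintegral_prod _ ((Measurable.indicator (by fun_prop) hS).aemeasurable),
    ← lintegral_const_mul _ (by fun_prop)]
  refine lintegral_congr fun x => ?_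
  have htG : 0 ≤ t * G x := mul_nonneg ht.le (hG₀ x)
  simp only [section_eq]
  rw [lintegral_indicator_const measurableSet_ball, EuclideanSpace.volume_ball_fin_two,
    ← ENNReal.ofReal_pow (Real.sqrt_nonneg _), Real.sq_sqrt htG, ← ENNReal.ofReal_mul htG,
    ← ENNReal.ofReal_mul (hG₀ x), ← ENNReal.ofReal_mul (by positivity)]
  congr 1
  ring

theorem lintegral_comp_fst_le_of_le_smul_prod (hν : ν ≤ M • m.prod volume) (ha : Measurable a)
    (hG : Measurable G) (hG₀ : ∀ x, 0 ≤ G x) (ht : 0 < t) :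
    ∫⁻ z, ENNReal.ofReal (G z.1) ∂ν
      ≤ ENNReal.ofReal t⁻¹ * ∫⁻ z, ENNReal.ofReal (‖z.2 + a z.1‖ ^ 2) ∂ν
        + M * (ENNReal.ofReal (Real.pi * t) * ∫⁻ x, ENNReal.ofReal (G x ^ 2) ∂m) := by
  -- Where `‖p + a‖² ≥ t G` the momentum pays for `G`; elsewhere `p` lies in a disc of area `π t G`.
  have split (z : X × Plane) : ENNReal.ofReal (G z.1)
      ≤ ENNReal.ofReal t⁻¹ * ENNReal.ofReal (‖z.2 + a z.1‖ ^ 2)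
        + {z : X × Plane | ‖z.2 + a z.1‖ ^ 2 < t * G z.1}.indicator
          (fun z => ENNReal.ofReal (G z.1)) z := by
    rcases lt_or_ge (‖z.2 + a z.1‖ ^ 2) (t * G z.1) with hz | hz
    · rw [Set.indicator_of_mem (by exact hz)]
      exact le_add_self
    · rw [← ENNReal.ofReal_mul (by positivity)]
      refine le_add_right (ENNReal.ofReal_le_ofReal ?_)
      rwa [inv_mul_eq_div, le_div_iff₀' ht]
  calc ∫⁻ z, ENNReal.ofReal (G z.1) ∂ν
      ≤ _ := lintegral_mono split
    _ = ENNReal.ofReal t⁻¹ * ∫⁻ z, ENNReal.ofReal (‖z.2 + a z.1‖ ^ 2) ∂ν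
        + ∫⁻ z, {z : X × Plane | ‖z.2 + a z.1‖ ^ 2 < t * G z.1}.indicator
          (fun z => ENNReal.ofReal (G z.1)) z ∂ν := by
        rw [lintegral_add_left (by fun_prop), lintegral_const_mul _ (by fun_prop)]
    _ ≤ _ := by
        gcongr
        refine (lintegral_mono' hν le_rfl).trans_eq ?_
        rw [lintegral_smul_measure, lintegral_indicator_norm_add_sq_lt ha hG hG₀ ht,
          ENNReal.smul_def, smul_eq_mul]

theorem integral_comp_fst_le_of_le_smul_prod (hν : ν ≤ M • m.prod volume) (ha : Measurable a)
    (hG : Measurable G) (hG₀ : ∀ x, 0 ≤ G x) (ht : 0 < t)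
    (hi : Integrable (fun z => ‖z.2 + a z.1‖ ^ 2) ν) (hG2 : Integrable (fun x => G x ^ 2) m) :
    ∫ z, G z.1 ∂ν ≤ t⁻¹ * ∫ z, ‖z.2 + a z.1‖ ^ 2 ∂ν + M * (Real.pi * t * ∫ x, G x ^ 2 ∂m) := by
  have h := lintegral_comp_fst_le_of_le_smul_prod hν ha hG hG₀ ht
  have h₁ : 0 ≤ ∫ z, ‖z.2 + a z.1‖ ^ 2 ∂ν := by positivity
  have h₂ : 0 ≤ ∫ x, G x ^ 2 ∂m := by positivity
  rw [← ofReal_integral_eq_lintegral_ofReal hi (.of_forall fun z => by positivity),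
    ← ofReal_integral_eq_lintegral_ofReal hG2 (.of_forall fun x => by positivity),
    ← ENNReal.ofReal_mul (by positivity), ← ENNReal.ofReal_mul (by positivity),
    ← ENNReal.ofReal_coe_nnreal, ← ENNReal.ofReal_mul M.coe_nonneg,
    ← ENNReal.ofReal_add (by positivity) (by positivity)] at h
  rw [integral_eq_lintegral_of_nonneg_ae (.of_forall fun z => hG₀ _)
    (hG.comp measurable_fst).aestronglyMeasurable]
  exact ENNReal.toReal_le_of_le_ofReal (by positivity) h

end Bathtub

section Grid

variable {lx lp L : ℝ} {m : (Fin 2 → ℤ) × (Fin 2 → ℤ)} {z z' : Phase} {μ : Measure Phase}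

theorem norm_le_two_mul_of_abs_le {v : Plane} {r : ℝ} (h : ∀ i, |v i| ≤ r) : ‖v‖ ≤ 2 * r := by
  have hr : 0 ≤ r := (abs_nonneg _).trans (h 0)
  rw [EuclideanSpace.norm_eq, Real.sqrt_le_left (by positivity)]
  simp only [Fin.sum_univ_two, Real.norm_eq_abs]
  nlinarith [pow_le_pow_left₀ (abs_nonneg _) (h 0) 2, pow_le_pow_left₀ (abs_nonneg _) (h 1) 2,
    sq_nonneg r]

theorem measurableSet_box (lx lp : ℝ) (m : (Fin 2 → ℤ) × (Fin 2 → ℤ)) :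
    MeasurableSet (box lx lp m) := by
  simp only [box, Set.ofPred_and, Set.ofPred_forall]
  refine .inter (.iInter fun i => .inter ?_ ?_) (.iInter fun i => .inter ?_ ?_)
  · exact measurableSet_le (by fun_prop) (by fun_prop)
  · exact measurableSet_lt (by fun_prop) (by fun_prop)
  · exact measurableSet_le (by fun_prop) (by fun_prop)
  · exact measurableSet_lt (by fun_prop) (by fun_prop)

theorem mem_box_iff (hlx : 0 < lx) (hlp : 0 < lp) :
    z ∈ box lx lp m ↔ m = (fun i => ⌊z.1 i / lx⌋, fun i => ⌊z.2 i / lp⌋) := by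
  simp only [box, Set.mem_ofPred_eq, Prod.ext_iff, funext_iff, eq_comm (a := m.1 _),
    eq_comm (a := m.2 _), Int.floor_eq_iff, le_div_iff₀ hlx, div_lt_iff₀ hlx, le_div_iff₀ hlp,
    div_lt_iff₀ hlp]

theorem pairwise_disjoint_box (hlx : 0 < lx) (hlp : 0 < lp) :
    Pairwise (Function.onFun Disjoint (box lx lp)) := fun _ _ hmm' =>
  Set.disjoint_left.2 fun _ hz hz' =>
    hmm' (((mem_box_iff hlx hlp).1 hz).trans ((mem_box_iff hlx hlp).1 hz').symm)

theorem abs_sub_le_of_mem_box (hz : z ∈ box lx lp m) (hz' : z' ∈ box lx lp m) :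
    (∀ i, |z.1 i - z'.1 i| ≤ lx) ∧ ∀ i, |z.2 i - z'.2 i| ≤ lp :=
  ⟨fun i => abs_le.2 ⟨by linarith [hz.1 i, hz'.1 i], by linarith [hz.1 i, hz'.1 i]⟩,
    fun i => abs_le.2 ⟨by linarith [hz.2 i, hz'.2 i], by linarith [hz.2 i, hz'.2 i]⟩⟩

theorem norm_sub_le_of_mem_box (hz : z ∈ box lx lp m) (hz' : z' ∈ box lx lp m) :
    ‖z.1 - z'.1‖ ≤ 2 * lx ∧ ‖z.2 - z'.2‖ ≤ 2 * lp :=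
  ⟨norm_le_two_mul_of_abs_le (abs_sub_le_of_mem_box hz hz').1,
    norm_le_two_mul_of_abs_le (abs_sub_le_of_mem_box hz hz').2⟩

theorem volume_box_ne_zero (hlx : 0 < lx) (hlp : 0 < lp) (m : (Fin 2 → ℤ) × (Fin 2 → ℤ)) :
    volume (box lx lp m) ≠ 0 := by
  let U : Set Phase := {z | (∀ i, m.1 i * lx < z.1 i ∧ z.1 i < (m.1 i + 1) * lx) ∧
    (∀ i, m.2 i * lp < z.2 i ∧ z.2 i < (m.2 i + 1) * lp)}
  have isOpen_U : IsOpen U := by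
    simp only [U, Set.ofPred_and, Set.ofPred_forall]
    refine .inter (isOpen_iInter_of_finite fun i => .inter ?_ ?_)
      (isOpen_iInter_of_finite fun i => .inter ?_ ?_)
    all_goals exact isOpen_lt (by fun_prop) (by fun_prop)
  have nonempty_U : U.Nonempty := by
    refine ⟨(WithLp.toLp 2 fun i => (m.1 i + 1 / 2) * lx,
      WithLp.toLp 2 fun i => (m.2 i + 1 / 2) * lp), fun i => ?_, fun i => ?_⟩ <;>
    constructor <;> simp only <;> nlinarith
  have subset_box : U ⊆ box lx lp m := fun z hz =>
    ⟨fun i => ⟨(hz.1 i).1.le, (hz.1 i).2⟩, fun i => ⟨(hz.2 i).1.le, (hz.2 i).2⟩⟩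
  exact ((isOpen_U.measure_pos volume nonempty_U).trans_le (measure_mono subset_box)).ne'

theorem cube_subset_closedBall_prod (L : ℝ) :
    cube L ⊆ Metric.closedBall 0 (2 * L) ×ˢ Metric.closedBall 0 (2 * L) := fun _ hz =>
  ⟨mem_closedBall_zero_iff.2 (norm_le_two_mul_of_abs_le hz.1),
    mem_closedBall_zero_iff.2 (norm_le_two_mul_of_abs_le hz.2)⟩

theorem measurableSet_cube (L : ℝ) : MeasurableSet (cube L) := by
  simp only [cube, Set.ofPred_and, Set.ofPred_forall]
  refine .inter (.iInter fun i => ?_) (.iInter fun i => ?_) <;>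
  exact measurableSet_le (by fun_prop) (by fun_prop)

theorem volume_cube_lt_top (L : ℝ) : volume (cube L) < ⊤ :=
  (measure_mono (cube_subset_closedBall_prod L)).trans_lt
    ((isCompact_closedBall _ _).prod (isCompact_closedBall _ _)).measure_lt_top

/-- The union of those boxes of the grid that lie inside the cube `S_L`; it carries `Ave[μ]`. -/
def innerRegion (lx lp L : ℝ) : Set Phase := ⋃ m : {m // box lx lp m ⊆ cube L}, box lx lp m

theorem measurableSet_innerRegion (lx lp L : ℝ) : MeasurableSet (innerRegion lx lp L) :=
  .iUnion fun _ => measurableSet_box _ _ _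

theorem innerRegion_subset_cube : innerRegion lx lp L ⊆ cube L := Set.iUnion_subset fun m => m.2

theorem mem_innerRegion_of_abs_le (hlx : 0 < lx) (hlp : 0 < lp) (hx : ∀ i, |z.1 i| ≤ L - lx)
    (hp : ∀ i, |z.2 i| ≤ L - lp) : z ∈ innerRegion lx lp L := by
  have hz := (mem_box_iff hlx hlp (z := z)).2 rfl
  refine Set.mem_iUnion.2 ⟨⟨_, fun w hw => ?_⟩, hz⟩
  have h := abs_sub_le_of_mem_box hw hz
  refine ⟨fun i => ?_, fun i => ?_⟩
  · linarith [abs_sub_abs_le_abs_sub (w.1 i) (z.1 i), h.1 i, hx i]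
  · linarith [abs_sub_abs_le_abs_sub (w.2 i) (z.2 i), h.2 i, hp i]

theorem pairwise_disjoint_innerBox (hlx : 0 < lx) (hlp : 0 < lp) :
    Pairwise (Function.onFun Disjoint fun m : {m // box lx lp m ⊆ cube L} => box lx lp m) :=
  (pairwise_disjoint_box hlx hlp).comp_of_injective Subtype.val_injective

theorem aveDensity_of_mem (hlx : 0 < lx) (hlp : 0 < lp) (hm : box lx lp m ⊆ cube L)
    (hz : z ∈ box lx lp m) :
    aveDensity lx lp L μ z = μ (box lx lp m) / volume (box lx lp m) := by
  rw [aveDensity, tsum_eq_single ⟨m, hm⟩, Set.indicator_of_mem hz]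
  intro m' hm'
  exact Set.indicator_of_notMem
    (Set.disjoint_left.1 (pairwise_disjoint_innerBox hlx hlp hm'.symm) hz) _

theorem aveDensity_of_notMem (hz : z ∉ innerRegion lx lp L) : aveDensity lx lp L μ z = 0 := by
  rw [aveDensity, ENNReal.tsum_eq_zero]
  exact fun m => Set.indicator_of_notMem (fun h => hz (Set.mem_iUnion.2 ⟨m, h⟩)) _

theorem ave_box (hlx : 0 < lx) (hlp : 0 < lp) (hm : box lx lp m ⊆ cube L) :
    ave lx lp L μ (box lx lp m) = μ (box lx lp m) := by
  rw [ave, withDensity_apply _ (measurableSet_box _ _ _),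
    setLIntegral_congr_fun (measurableSet_box _ _ _)
      (fun z hz => aveDensity_of_mem hlx hlp hm hz), setLIntegral_const]
  exact ENNReal.div_mul_cancel (volume_box_ne_zero hlx hlp _)
    ((measure_mono hm).trans_lt (volume_cube_lt_top L)).ne

theorem ave_restrict_innerRegion (lx lp L : ℝ) (μ : Measure Phase) :
    (ave lx lp L μ).restrict (innerRegion lx lp L) = ave lx lp L μ := by
  have null_compl : ave lx lp L μ (innerRegion lx lp L)ᶜ = 0 := by
    rw [ave, withDensity_apply _ (measurableSet_innerRegion _ _ _).compl,
      setLIntegral_congr_fun (measurableSet_innerRegion _ _ _).compl (g := fun _ => 0)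
        (fun z hz => aveDensity_of_notMem hz), lintegral_zero]
  exact Measure.restrict_eq_self_of_ae_mem null_compl

theorem ave_univ (hlx : 0 < lx) (hlp : 0 < lp) :
    ave lx lp L μ Set.univ = μ (innerRegion lx lp L) := by
  rw [← ave_restrict_innerRegion, Measure.restrict_apply_univ, innerRegion,
    measure_iUnion (pairwise_disjoint_innerBox hlx hlp) fun _ => measurableSet_box _ _ _,
    measure_iUnion (pairwise_disjoint_innerBox hlx hlp) fun _ => measurableSet_box _ _ _]
  exact tsum_congr fun m => ave_box hlx hlp m.2

theorem ave_le_of_box_le (hlx : 0 < lx) (hlp : 0 < lp) {M : ℝ≥0}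
    (h : ∀ m, box lx lp m ⊆ cube L → μ (box lx lp m) ≤ M * volume (box lx lp m)) :
    ave lx lp L μ ≤ M • volume.restrict (cube L) := by
  have density_le : aveDensity lx lp L μ ≤ (cube L).indicator fun _ => (M : ℝ≥0∞) := by
    intro z
    by_cases hz : z ∈ innerRegion lx lp L
    · obtain ⟨m, hm⟩ := Set.mem_iUnion.1 hz
      rw [aveDensity_of_mem hlx hlp m.2 hm, Set.indicator_of_mem (innerRegion_subset_cube hz)]
      exact ENNReal.div_le_of_le_mul (h _ m.2)
    · rw [aveDensity_of_notMem hz]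
      exact zero_le
  refine (withDensity_mono (.of_forall density_le)).trans_eq ?_
  rw [withDensity_indicator (measurableSet_cube L), withDensity_const]
  rfl

theorem isFiniteMeasure_ave (hlx : 0 < lx) (hlp : 0 < lp) [IsFiniteMeasure μ] :
    IsFiniteMeasure (ave lx lp L μ) :=
  ⟨by rw [ave_univ hlx hlp]; exact measure_lt_top _ _⟩

variable [IsFiniteMeasure μ]

theorem integral_ave_le_setIntegral (hlx : 0 < lx) (hlp : 0 < lp) {f g : Phase → ℝ}
    (hf : Integrable f (ave lx lp L μ)) (hg : IntegrableOn g (innerRegion lx lp L) μ)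
    (h : ∀ z z', ‖z.1 - z'.1‖ ≤ 2 * lx → ‖z.2 - z'.2‖ ≤ 2 * lp → f z ≤ g z') :
    ∫ z, f z ∂(ave lx lp L μ) ≤ ∫ z in innerRegion lx lp L, g z ∂μ := by
  have := isFiniteMeasure_ave (L := L) (μ := μ) hlx hlp
  rw [← ave_restrict_innerRegion]
  exact setIntegral_iUnion_le_of_measure_eq (fun _ => measurableSet_box _ _ _)
    (pairwise_disjoint_innerBox hlx hlp) (fun m => ave_box hlx hlp m.2)
    (fun _ => measure_ne_top _ _) hf.integrableOn hg fun _ z hz z' hz' =>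
      h z z' (norm_sub_le_of_mem_box hz hz').1 (norm_sub_le_of_mem_box hz hz').2

theorem norm_setIntegral_sub_integral_ave_le {E : Type*} [NormedAddCommGroup E]
    [InnerProductSpace ℝ E] [CompleteSpace E] (hlx : 0 < lx) (hlp : 0 < lp) {F F' : Phase → E}
    {G : Phase → ℝ} (hF : IntegrableOn F (innerRegion lx lp L) μ)
    (hF' : Integrable F' (ave lx lp L μ)) (hG : Integrable G (ave lx lp L μ))
    (h : ∀ z z', ‖z.1 - z'.1‖ ≤ 2 * lx → ‖z.2 - z'.2‖ ≤ 2 * lp → ‖F z - F' z'‖ ≤ G z') :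
    ‖∫ z in innerRegion lx lp L, F z ∂μ - ∫ z, F' z ∂(ave lx lp L μ)‖
      ≤ ∫ z, G z ∂(ave lx lp L μ) := by
  rw [← ave_restrict_innerRegion]
  exact norm_setIntegral_iUnion_sub_le_of_measure_eq (fun _ => measurableSet_box _ _ _)
    (pairwise_disjoint_innerBox hlx hlp) (fun m => (ave_box hlx hlp m.2).symm)
    (fun _ => measure_ne_top _ _) hF hF'.integrableOn hG.integrableOn fun _ z hz z' hz' =>
      h z z' (norm_sub_le_of_mem_box hz hz').1 (norm_sub_le_of_mem_box hz hz').2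

end Grid

section ExternalPotentials

theorem one_add_rpow_le_mul_one_add_rpow {x s : ℝ} (hx : 0 ≤ x) (hs : 1 ≤ s) :
    (1 + x) ^ s ≤ 2 ^ (s - 1) * (1 + x ^ s) := by
  lift x to ℝ≥0 using hx
  have h := NNReal.rpow_add_le_mul_rpow_add_rpow 1 x hs
  rw [NNReal.one_rpow] at h
  exact_mod_cast h

variable {Ae : Plane → Plane} {V : Plane → ℝ} {s : ℝ}

namespace ExternalPotentials

theorem continuous_Ae (h : ExternalPotentials Ae V s) : Continuous Ae :=
  h.differentiable_Ae.continuous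

theorem continuous_V (h : ExternalPotentials Ae V s) : Continuous V :=
  h.differentiable_V.continuous

theorem exists_one_add_norm_rpow_le (h : ExternalPotentials Ae V s) :
    ∃ K : ℝ, 0 < K ∧ ∀ x, (1 + ‖x‖) ^ s ≤ K * (1 + V x) := by
  obtain ⟨c, C, hc, hV⟩ := h.growth_V
  refine ⟨2 ^ (s - 1) * (1 + (|C| + 1) / c), by positivity, fun x => ?_⟩
  have rpow_le : ‖x‖ ^ s ≤ (|C| + V x) / c := by
    rw [le_div_iff₀' hc]
    linarith [hV x, le_abs_self C]
  calc (1 + ‖x‖) ^ s ≤ 2 ^ (s - 1) * (1 + ‖x‖ ^ s) :=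
        one_add_rpow_le_mul_one_add_rpow (norm_nonneg x) h.one_lt_s.le
    _ ≤ 2 ^ (s - 1) * ((1 + (|C| + 1) / c) * (1 + V x)) := by
        gcongr
        calc 1 + ‖x‖ ^ s ≤ 1 + (|C| + V x) / c := by gcongr
          _ ≤ 1 + (|C| + V x) / c + (V x + (|C| * V x + 1) / c) := by
              have := h.nonneg_V x
              exact le_add_of_nonneg_right (by positivity)
          _ = (1 + (|C| + 1) / c) * (1 + V x) := by ring
    _ = _ := (mul_assoc _ _ _).symm

theorem exists_norm_fderiv_V_le (h : ExternalPotentials Ae V s) :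
    ∃ K : ℝ, 0 < K ∧ ∀ x y, ‖x - y‖ ≤ 1 → ‖fderiv ℝ V x‖ ≤ K * (1 + V y) := by
  obtain ⟨K, hK, rpow_le⟩ := h.exists_one_add_norm_rpow_le
  obtain ⟨c, C, hg⟩ := h.growth_gradient_V
  have hs := h.one_lt_s
  refine ⟨(|c| + |C| + 1) * K, by positivity, fun x y hxy => ?_⟩
  have hx : ‖x‖ ≤ 1 + ‖y‖ := by linarith [norm_sub_norm_le x y]
  have hy : 1 ≤ 1 + ‖y‖ := le_add_of_nonneg_right (norm_nonneg y)
  have rpow_le_rpow : ‖x‖ ^ (s - 1) ≤ (1 + ‖y‖) ^ s :=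
    (Real.rpow_le_rpow (norm_nonneg _) hx (by linarith)).trans
      (Real.rpow_le_rpow_of_exponent_le hy (by linarith))
  have one_le_rpow : 1 ≤ (1 + ‖y‖) ^ s := Real.one_le_rpow hy (by linarith)
  calc ‖fderiv ℝ V x‖ = ‖gradient V x‖ := by simp only [gradient, LinearIsometryEquiv.norm_map]
    _ ≤ |c| * ‖x‖ ^ (s - 1) + |C| * 1 := by
        rw [mul_one]
        exact (hg x).trans (by gcongr <;> exact le_abs_self _)
    _ ≤ |c| * (1 + ‖y‖) ^ s + |C| * (1 + ‖y‖) ^ s := by gcongr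
    _ ≤ (|c| + |C| + 1) * (1 + ‖y‖) ^ s := by linarith
    _ ≤ (|c| + |C| + 1) * (K * (1 + V y)) := by gcongr; exact rpow_le y
    _ = _ := (mul_assoc _ _ _).symm

theorem exists_V_sub_le (h : ExternalPotentials Ae V s) :
    ∃ K : ℝ, 0 < K ∧ ∀ x y, ‖x - y‖ ≤ 1 → V x - V y ≤ K * ‖x - y‖ * (1 + V y) := by
  obtain ⟨K, hK, fderiv_le⟩ := h.exists_norm_fderiv_V_le
  refine ⟨K, hK, fun x y hxy => ?_⟩
  have image_sub_le := (convex_closedBall y 1).norm_image_sub_le_of_norm_fderiv_le (𝕜 := ℝ)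
    (fun z _ => h.differentiable_V z) (fun z hz => fderiv_le z y (mem_closedBall_iff_norm.1 hz))
    (Metric.mem_closedBall_self zero_le_one) (mem_closedBall_iff_norm.2 hxy)
  exact (Real.le_norm_self _).trans (image_sub_le.trans_eq (by ring))

theorem exists_lipschitzWith_Ae (h : ExternalPotentials Ae V s) : ∃ K, LipschitzWith K Ae := by
  obtain ⟨K, hK⟩ := h.bounded_fderiv_Ae
  refine ⟨K.toNNReal, lipschitzWith_of_nnnorm_fderiv_le h.differentiable_Ae fun x => ?_⟩
  exact NNReal.coe_le_coe.1 ((hK x).trans (Real.le_coe_toNNReal K))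

theorem exists_le_of_notMem_innerRegion (h : ExternalPotentials Ae V s) :
    ∃ L₀ c : ℝ, 2 ≤ L₀ ∧ 0 < c ∧ ∀ L lx lp : ℝ, L₀ ≤ L → 0 < lx → lx ≤ 1 → 0 < lp → lp ≤ 1 →
      ∀ z ∉ innerRegion lx lp L, c * min (L ^ 2) (L ^ s) ≤ ‖z.2‖ ^ 2 + V z.1 := by
  obtain ⟨c, C, hc, hV⟩ := h.growth_V
  have hs := h.one_lt_s
  refine ⟨2 + 4 * |C| / c, min (1 / 4) (c / 2 / 2 ^ s),
    le_add_of_nonneg_right (by positivity), by positivity, ?_⟩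
  intro L lx lp hL hlx hlx₁ hlp hlp₁ z hz
  have two_le : 2 ≤ L := (le_add_of_nonneg_right (by positivity)).trans hL
  have abs_le_mul : 2 * |C| ≤ c * (L / 2) := by
    have : 4 * |C| / c ≤ L := by linarith
    rw [div_le_iff₀' hc] at this
    linarith
  have large_coordinate : (∃ i, L / 2 ≤ |z.1 i|) ∨ ∃ i, L / 2 ≤ |z.2 i| := by
    by_contra! small
    exact hz (mem_innerRegion_of_abs_le hlx hlp (fun i => by linarith [small.1 i])
      fun i => by linarith [small.2 i])
  rcases large_coordinate with ⟨i, hi⟩ | ⟨i, hi⟩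
  · have rpow_le : (L / 2) ^ s ≤ ‖z.1‖ ^ s := by
      gcongr
      exact hi.trans (PiLp.norm_apply_le z.1 i)
    have le_rpow : L / 2 ≤ (L / 2) ^ s := Real.self_le_rpow_of_one_le (by linarith) hs.le
    calc min (1 / 4) (c / 2 / 2 ^ s) * min (L ^ 2) (L ^ s) ≤ c / 2 / 2 ^ s * L ^ s := by
          gcongr <;> apply min_le_right
      _ = c / 2 * (L / 2) ^ s := by rw [Real.div_rpow (by linarith) zero_le_two]; ring
      _ ≤ c * ‖z.1‖ ^ s - C := by nlinarith [le_abs_self C]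
      _ ≤ V z.1 := hV _
      _ ≤ ‖z.2‖ ^ 2 + V z.1 := le_add_of_nonneg_left (sq_nonneg _)
  · calc min (1 / 4) (c / 2 / 2 ^ s) * min (L ^ 2) (L ^ s) ≤ 1 / 4 * L ^ 2 := by
          gcongr <;> apply min_le_left
      _ = (L / 2) ^ 2 := by ring
      _ ≤ ‖z.2‖ ^ 2 := by
          gcongr
          exact hi.trans (PiLp.norm_apply_le z.2 i)
      _ ≤ ‖z.2‖ ^ 2 + V z.1 := le_add_of_nonneg_right (h.nonneg_V _)

end ExternalPotentials

end ExternalPotentials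

section InvNormPow

variable {E : Type*} [NormedAddCommGroup E] [NormedSpace ℝ E] {n : ℕ} {R : ℝ}

theorem inv_add_norm_sub_pow_eq (hR : 0 < R) (n : ℕ) (x y : E) :
    ((R + ‖x - y‖) ^ n)⁻¹ = (R ^ n)⁻¹ * ((1 + ‖R⁻¹ • (x - y)‖) ^ n)⁻¹ := by
  rw [norm_smul, Real.norm_of_nonneg (by positivity), ← mul_inv, ← mul_pow, mul_add, mul_one,
    mul_inv_cancel_left₀ hR.ne']

variable [FiniteDimensional ℝ E] [MeasurableSpace E] [BorelSpace E] {μ : Measure E}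
  [μ.IsAddHaarMeasure]

theorem integrable_inv_one_add_norm_pow (hn : Module.finrank ℝ E < n) :
    Integrable (fun y : E => ((1 + ‖y‖) ^ n)⁻¹) μ := by
  refine (integrable_one_add_norm (r := n) (by exact_mod_cast hn)).congr (.of_forall fun y => ?_)
  simp only [Real.rpow_neg (by positivity : 0 ≤ 1 + ‖y‖), Real.rpow_natCast]

theorem integrable_inv_add_norm_sub_pow (hn : Module.finrank ℝ E < n) (hR : 0 < R) (x : E) :
    Integrable (fun y => ((R + ‖x - y‖) ^ n)⁻¹) μ := by
  simp only [inv_add_norm_sub_pow_eq hR]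
  have h := (integrable_comp_smul_iff μ (fun y : E => ((1 + ‖y‖) ^ n)⁻¹) (inv_ne_zero hR.ne')).2
    (integrable_inv_one_add_norm_pow hn)
  exact (h.comp_sub_left x).const_mul _

theorem integral_inv_add_norm_sub_pow (hR : 0 < R) (n : ℕ) (x : E) :
    ∫ y, ((R + ‖x - y‖) ^ n)⁻¹ ∂μ
      = (R ^ n)⁻¹ * (R ^ Module.finrank ℝ E * ∫ y, ((1 + ‖y‖) ^ n)⁻¹ ∂μ) := by
  simp only [inv_add_norm_sub_pow_eq hR]
  rw [integral_const_mul, integral_sub_left_eq_self (fun y : E => ((1 + ‖R⁻¹ • y‖) ^ n)⁻¹) μ x,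
    Measure.integral_comp_smul μ (fun y : E => ((1 + ‖y‖) ^ n)⁻¹) R⁻¹, inv_pow, inv_inv,
    abs_of_pos (by positivity), smul_eq_mul]

end InvNormPow

section VectorPotential

variable {χ : Plane → ℝ} {R : ℝ}

namespace SmearingProfile

theorem exists_norm_perpGrad_le_div (hχ : SmearingProfile χ) :
    ∃ C, 0 < C ∧ ∀ R, 0 < R → ∀ x, ‖perpGrad χ R x‖ ≤ C / R := by
  obtain ⟨C, hC, norm_le⟩ := hχ.exists_norm_perpGrad_le
  refine ⟨C, hC, fun R hR x => (norm_le R hR x).trans ?_⟩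
  gcongr
  exact le_add_of_nonneg_right (norm_nonneg x)

theorem aestronglyMeasurable_perpGrad_sub (hχ : SmearingProfile χ) (hR : 0 < R)
    (ρ : Measure Plane) (x : Plane) : AEStronglyMeasurable (fun y => perpGrad χ R (x - y)) ρ :=
  ((hχ.continuous_perpGrad hR).comp (by fun_prop)).aestronglyMeasurable

theorem vectorPotential_fst (hχ : SmearingProfile χ) (hR : 0 < R) (μ : Measure Phase) (x : Plane) :
    vectorPotential χ R μ.fst x = ∫ z, perpGrad χ R (x - z.1) ∂μ :=
  integral_map measurable_fst.aemeasurable (hχ.aestronglyMeasurable_perpGrad_sub hR _ x)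

variable {ρ : Measure Plane} [IsFiniteMeasure ρ]

theorem integrable_perpGrad_sub (hχ : SmearingProfile χ) (hR : 0 < R) (x : Plane) :
    Integrable (fun y => perpGrad χ R (x - y)) ρ := by
  obtain ⟨C, -, norm_le⟩ := hχ.exists_norm_perpGrad_le_div
  exact .of_bound (hχ.aestronglyMeasurable_perpGrad_sub hR ρ x) (C / R)
    (.of_forall fun y => norm_le R hR _)

theorem vectorPotential_add (hχ : SmearingProfile χ) (hR : 0 < R) {ρ' : Measure Plane}
    [IsFiniteMeasure ρ'] (x : Plane) :
    vectorPotential χ R (ρ + ρ') x = vectorPotential χ R ρ x + vectorPotential χ R ρ' x :=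
  integral_add_measure (hχ.integrable_perpGrad_sub hR x) (hχ.integrable_perpGrad_sub hR x)

theorem continuous_vectorPotential (hχ : SmearingProfile χ) (hR : 0 < R) :
    Continuous (vectorPotential χ R ρ) := by
  obtain ⟨C, -, norm_le⟩ := hχ.exists_norm_perpGrad_le_div
  refine continuous_of_dominated (bound := fun _ => C / R)
    (fun x => hχ.aestronglyMeasurable_perpGrad_sub hR ρ x)
    (fun x => .of_forall fun y => norm_le R hR _) (integrable_const _)
    (.of_forall fun y => (hχ.continuous_perpGrad hR).comp (by fun_prop))

theorem exists_norm_vectorPotential_le (hχ : SmearingProfile χ) :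
    ∃ C, 0 < C ∧ ∀ (R : ℝ) (ρ : Measure Plane) [IsFiniteMeasure ρ] (x : Plane), 0 < R →
      ‖vectorPotential χ R ρ x‖ ≤ C / R * ρ.real Set.univ := by
  obtain ⟨C, hC, norm_le⟩ := hχ.exists_norm_perpGrad_le_div
  exact ⟨C, hC, fun R ρ _ x hR =>
    norm_integral_le_of_norm_le_const (.of_forall fun y => norm_le R hR _)⟩

theorem exists_norm_vectorPotential_sub_ave_le (hχ : SmearingProfile χ) :
    ∃ C, 0 < C ∧ ∀ (R lx lp L : ℝ) (μ : Measure Phase) [IsFiniteMeasure μ] (x x' : Plane),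
      0 < R → 0 < lx → 0 < lp → 4 * lx ≤ R → ‖x - x'‖ ≤ 2 * lx →
      ‖vectorPotential χ R (μ.restrict (innerRegion lx lp L)).fst x
          - vectorPotential χ R (ave lx lp L μ).fst x'‖
        ≤ C * lx * ∫ w, ((R + ‖x' - w.1‖) ^ 2)⁻¹ ∂(ave lx lp L μ) := by
  obtain ⟨C, hC, perpGrad_sub_le⟩ := hχ.exists_norm_perpGrad_sub_le
  refine ⟨C * 4, by positivity, fun R lx lp L μ _ x x' hR hlx hlp hlxR hxx' => ?_⟩
  have := isFiniteMeasure_ave (L := L) (μ := μ) hlx hlp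
  have integrable_field (ν : Measure Phase) [IsFiniteMeasure ν] (y : Plane) :
      Integrable (fun w => perpGrad χ R (y - w.1)) ν :=
    (hχ.integrable_perpGrad_sub hR y).comp_measurable measurable_fst
  have integrable_bound :
      Integrable (fun w : Phase => ((R + ‖x' - w.1‖) ^ 2)⁻¹) (ave lx lp L μ) := by
    refine .of_bound (by fun_prop) (R ^ 2)⁻¹ (.of_forall fun w => ?_)
    rw [Real.norm_of_nonneg (by positivity)]
    gcongr
    exact le_add_of_nonneg_right (norm_nonneg _)
  rw [hχ.vectorPotential_fst hR, hχ.vectorPotential_fst hR, ← integral_const_mul]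
  refine norm_setIntegral_sub_integral_ave_le hlx hlp (integrable_field _ x) (integrable_field _ x')
    (integrable_bound.const_mul _) fun w w' hw _ => ?_
  have norm_le : ‖x' - w'.1 - (x - w.1)‖ ≤ 4 * lx :=
    calc ‖x' - w'.1 - (x - w.1)‖ = ‖(w.1 - w'.1) - (x - x')‖ := by congr 1; abel
      _ ≤ ‖w.1 - w'.1‖ + ‖x - x'‖ := norm_sub_le _ _
      _ ≤ 4 * lx := by linarith
  calc ‖perpGrad χ R (x - w.1) - perpGrad χ R (x' - w'.1)‖
      ≤ C * ‖x' - w'.1 - (x - w.1)‖ / (R + ‖x' - w'.1‖) ^ 2 := by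
        rw [norm_sub_rev]
        exact perpGrad_sub_le R hR _ _ (norm_le.trans hlxR)
    _ ≤ C * (4 * lx) / (R + ‖x' - w'.1‖) ^ 2 := by gcongr
    _ = C * 4 * lx * ((R + ‖x' - w'.1‖) ^ 2)⁻¹ := by ring

end SmearingProfile

theorem integral_inv_add_norm_sub_sq_le_mul_sqrt {M : ℝ≥0} {ν : Measure Phase}
    (hν : ν ≤ M • volume) {a : Plane → Plane} (ha : Measurable a)
    (hi : Integrable (fun z => ‖z.2 + a z.1‖ ^ 2) ν) (hR : 0 < R) (x : Plane) :
    ∫ z, ((R + ‖x - z.1‖) ^ 2)⁻¹ ∂ν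
      ≤ (1 + M * (Real.pi * ∫ y : Plane, ((1 + ‖y‖) ^ 4)⁻¹))
        * (R⁻¹ * √(1 + ∫ z, ‖z.2 + a z.1‖ ^ 2 ∂ν)) := by
  set T := ∫ z, ‖z.2 + a z.1‖ ^ 2 ∂ν
  have hT : 0 ≤ T := integral_nonneg fun z => by positivity
  have inv_sq_sq (y : Plane) : (((R + ‖x - y‖) ^ 2)⁻¹) ^ 2 = ((R + ‖x - y‖) ^ 4)⁻¹ := by
    rw [inv_pow, ← pow_mul]
  have inv_mul_le : (R * √(1 + T))⁻¹ * T ≤ R⁻¹ * √(1 + T) := by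
    rw [mul_inv, mul_assoc]
    gcongr
    rw [inv_mul_le_iff₀ (by positivity), Real.mul_self_sqrt (by positivity)]
    exact le_add_of_nonneg_left zero_le_one
  -- The two contributions to the bathtub bound balance at the height `t = R √(1 + T)`.
  have bathtub := integral_comp_fst_le_of_le_smul_prod (m := volume) hν ha
    (G := fun y => ((R + ‖x - y‖) ^ 2)⁻¹) (by fun_prop) (fun y => by positivity)
    (t := R * √(1 + T)) (by positivity) hi
    (by simpa only [inv_sq_sq] using integrable_inv_add_norm_sub_pow (n := 4) (by simp) hR x)
  simp only [inv_sq_sq] at bathtub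
  rw [integral_inv_add_norm_sub_pow hR, finrank_euclideanSpace_fin] at bathtub
  refine bathtub.trans ((add_le_add_left inv_mul_le _).trans_eq ?_)
  field_simp

end VectorPotential

section Energy

theorem norm_add_sq_le_one_add_mul {E : Type*} [SeminormedAddCommGroup E] (u v : E) {κ : ℝ}
    (hκ : 0 < κ) : ‖u + v‖ ^ 2 ≤ (1 + κ) * ‖u‖ ^ 2 + (1 + κ⁻¹) * ‖v‖ ^ 2 := by
  have young : 0 ≤ κ⁻¹ * (κ * ‖u‖ - ‖v‖) ^ 2 := by positivity
  calc ‖u + v‖ ^ 2 ≤ (‖u‖ + ‖v‖) ^ 2 := by gcongr; exact norm_add_le u v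
    _ ≤ (‖u‖ + ‖v‖) ^ 2 + κ⁻¹ * (κ * ‖u‖ - ‖v‖) ^ 2 := le_add_of_nonneg_right young
    _ = (1 + κ) * ‖u‖ ^ 2 + (1 + κ⁻¹) * ‖v‖ ^ 2 := by field_simp; ring

theorem one_sub_mul_norm_sq_le {E : Type*} [SeminormedAddCommGroup E] (u v : E) {σ : ℝ}
    (hσ : 0 < σ) : (1 - σ) * ‖u‖ ^ 2 ≤ ‖u + v‖ ^ 2 + σ⁻¹ * ‖v‖ ^ 2 := by
  have young : 0 ≤ σ⁻¹ * (σ * ‖u‖ - ‖v‖) ^ 2 := by positivity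
  have sq_le : (‖u‖ - ‖v‖) ^ 2 ≤ ‖u + v‖ ^ 2 := by
    have h := abs_norm_sub_norm_le u (-v)
    rw [norm_neg, sub_neg_eq_add] at h
    exact sq_le_sq.2 (h.trans (le_abs_self _))
  calc (1 - σ) * ‖u‖ ^ 2
      = (‖u‖ - ‖v‖) ^ 2 + σ⁻¹ * ‖v‖ ^ 2 - (σ⁻¹ * (σ * ‖u‖ - ‖v‖) ^ 2 + ‖v‖ ^ 2) := by
        field_simp
        ring
    _ ≤ ‖u + v‖ ^ 2 + σ⁻¹ * ‖v‖ ^ 2 := by linarith [sq_nonneg ‖v‖]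

/-- The mechanical momentum `p + Ae(x) + β A^R[ρ](x)` at `z = (x, p)`, in the field of the charge
distribution `ρ`. The distribution is a separate argument, so that the momenta in the fields of two
distributions can be compared. -/
def mechanicalMomentum (Ae : Plane → Plane) (β : ℝ) (χ : Plane → ℝ) (R : ℝ) (ρ : Measure Plane)
    (z : Phase) : Plane :=
  z.2 + Ae z.1 + β • vectorPotential χ R ρ z.1

variable {Ae : Plane → Plane} {V : Plane → ℝ} {s β : ℝ} {χ : Plane → ℝ} {R : ℝ}

theorem vlasovEnergy_eq (hV : Continuous V) (μ : Measure Phase) :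
    vlasovEnergy Ae V β χ R μ
      = ∫ z, ‖mechanicalMomentum Ae β χ R μ.fst z‖ ^ 2 ∂μ + ∫ z, V z.1 ∂μ := by
  rw [vlasovEnergy, Measure.fst,
    integral_map measurable_fst.aemeasurable hV.aestronglyMeasurable]
  rfl

theorem continuous_mechanicalMomentum (hAe : Continuous Ae) (hχ : SmearingProfile χ) (hR : 0 < R)
    {ρ : Measure Plane} [IsFiniteMeasure ρ] : Continuous (mechanicalMomentum Ae β χ R ρ) := by
  have := hχ.continuous_vectorPotential hR (ρ := ρ)
  unfold mechanicalMomentum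
  fun_prop

theorem integrable_of_le_smul_restrict_cube {E : Type*} [NormedAddCommGroup E] {ν : Measure Phase}
    {M : ℝ≥0} {L : ℝ} (hν : ν ≤ M • volume.restrict (cube L)) {f : Phase → E}
    (hf : Continuous f) : Integrable f ν := by
  have hK : IsCompact (Metric.closedBall (0 : Plane) (2 * L) ×ˢ Metric.closedBall (0 : Plane) _) :=
    (isCompact_closedBall _ (2 * L)).prod (isCompact_closedBall _ (2 * L))
  have hfK := (hf.continuousOn.integrableOn_compact hK (μ := volume)).mono_set
    (cube_subset_closedBall_prod L)
  exact (hfK.smul_measure_nnreal (c := M)).mono_measure hν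

theorem SmearingProfile.exists_one_sub_mul_norm_mechanicalMomentum_restrict_sq_le
    (hχ : SmearingProfile χ) (Ae : Plane → Plane) (β : ℝ) :
    ∃ K, 0 < K ∧ ∀ (R σ : ℝ) (μ : Measure Phase) [IsFiniteMeasure μ] (U : Set Phase),
      0 < R → 0 < σ → MeasurableSet U → ∀ z,
      (1 - σ) * ‖mechanicalMomentum Ae β χ R (μ.restrict U).fst z‖ ^ 2
        ≤ ‖mechanicalMomentum Ae β χ R μ.fst z‖ ^ 2 + K * (μ.real Uᶜ ^ 2 / (σ * R ^ 2)) := by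
  obtain ⟨C, hC, field_le⟩ := hχ.exists_norm_vectorPotential_le
  refine ⟨(|β| * C) ^ 2 + 1, by positivity, fun R σ μ _ U hR hσ hU z => ?_⟩
  have eq_add : mechanicalMomentum Ae β χ R μ.fst z
      = mechanicalMomentum Ae β χ R (μ.restrict U).fst z
        + β • vectorPotential χ R (μ.restrict Uᶜ).fst z.1 := by
    rw [mechanicalMomentum, mechanicalMomentum, add_assoc _ (β • _), ← smul_add,
      ← hχ.vectorPotential_add hR, ← Measure.fst_add, Measure.restrict_add_restrict_compl hU]
  have outer_le : ‖β • vectorPotential χ R (μ.restrict Uᶜ).fst z.1‖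
      ≤ |β| * (C / R * μ.real Uᶜ) := by
    have h := field_le R (μ.restrict Uᶜ).fst z.1 hR
    rw [measureReal_def, Measure.fst_univ, ← measureReal_def,
      measureReal_restrict_apply_univ] at h
    rw [norm_smul, Real.norm_eq_abs]
    exact mul_le_mul_of_nonneg_left h (abs_nonneg β)
  rw [eq_add]
  refine (one_sub_mul_norm_sq_le _ _ hσ).trans (add_le_add_right ?_ _)
  calc σ⁻¹ * ‖β • vectorPotential χ R (μ.restrict Uᶜ).fst z.1‖ ^ 2
      ≤ σ⁻¹ * (|β| * (C / R * μ.real Uᶜ)) ^ 2 := by gcongr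
    _ = (|β| * C) ^ 2 * (μ.real Uᶜ ^ 2 / (σ * R ^ 2)) := by field_simp
    _ ≤ _ := by gcongr; exact le_add_of_nonneg_right zero_le_one

namespace ExternalPotentials

theorem vlasovEnergy_nonneg (h : ExternalPotentials Ae V s) (μ : Measure Phase) :
    0 ≤ vlasovEnergy Ae V β χ R μ :=
  add_nonneg (integral_nonneg fun z => by positivity) (integral_nonneg h.nonneg_V)

theorem integrable_norm_mechanicalMomentum_sq (h : ExternalPotentials Ae V s)
    (hχ : SmearingProfile χ) (hR : 0 < R) {ρ : Measure Plane} [IsFiniteMeasure ρ]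
    {μ : Measure Phase} [IsFiniteMeasure μ] (hμ : Integrable (fun z => ‖z.2‖ ^ 2) μ) :
    Integrable (fun z => ‖mechanicalMomentum Ae β χ R ρ z‖ ^ 2) μ := by
  obtain ⟨A, hA⟩ := h.bounded_Ae
  obtain ⟨C, -, hC⟩ := hχ.exists_norm_vectorPotential_le
  have hAe := h.continuous_Ae
  have hfield := hχ.continuous_vectorPotential hR (ρ := ρ)
  have memLp_snd : MemLp (fun z : Phase => z.2) 2 μ :=
    (memLp_two_iff_integrable_sq_norm (by fun_prop)).2 hμ
  have memLp_Ae : MemLp (fun z : Phase => Ae z.1) 2 μ :=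
    .of_bound (by fun_prop) A (.of_forall fun z => hA _)
  have memLp_field : MemLp (fun z : Phase => vectorPotential χ R ρ z.1) 2 μ :=
    .of_bound (by fun_prop) _ (.of_forall fun z => hC R ρ z.1 hR)
  exact ((memLp_snd.add memLp_Ae).add (memLp_field.const_smul β)).integrable_norm_pow two_ne_zero

theorem exists_one_sub_mul_vlasovEnergy_restrict_le (h : ExternalPotentials Ae V s)
    (hχ : SmearingProfile χ) (β : ℝ) :
    ∃ K, 0 < K ∧ ∀ (R σ : ℝ) (μ : Measure Phase) [IsProbabilityMeasure μ] (U : Set Phase),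
      0 < R → 0 < σ → MeasurableSet U → Integrable (fun z => ‖z.2‖ ^ 2) μ →
      Integrable (fun z => V z.1) μ →
      (1 - σ) * vlasovEnergy Ae V β χ R (μ.restrict U)
        ≤ vlasovEnergy Ae V β χ R μ + K * (μ.real Uᶜ ^ 2 / (σ * R ^ 2)) := by
  obtain ⟨K, hK, momentum_le⟩ :=
    hχ.exists_one_sub_mul_norm_mechanicalMomentum_restrict_sq_le Ae β
  refine ⟨K, hK, fun R σ μ _ U hR hσ hU hp hVi => ?_⟩
  have kinetic_le : (1 - σ) * ∫ z in U, ‖mechanicalMomentum Ae β χ R (μ.restrict U).fst z‖ ^ 2 ∂μ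
      ≤ ∫ z, ‖mechanicalMomentum Ae β χ R μ.fst z‖ ^ 2 ∂μ
        + K * (μ.real Uᶜ ^ 2 / (σ * R ^ 2)) := by
    have hi := h.integrable_norm_mechanicalMomentum_sq (β := β) hχ hR (ρ := μ.fst) hp
    have hiU := h.integrable_norm_mechanicalMomentum_sq (β := β) hχ hR (ρ := (μ.restrict U).fst) hp
    have hi' := hi.add (integrable_const (K * (μ.real Uᶜ ^ 2 / (σ * R ^ 2))))
    rw [← integral_const_mul]
    refine (integral_mono (hiU.integrableOn.const_mul _) hi'.integrableOn fun z =>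
      momentum_le R σ μ U hR hσ hU z).trans
      ((setIntegral_le_integral hi' (.of_forall fun z => ?_)).trans_eq ?_)
    · exact add_nonneg (sq_nonneg _) (by positivity)
    · simp only [Pi.add_apply]
      rw [integral_add hi (integrable_const _), integral_const, probReal_univ, one_smul]
  have potential_le : (1 - σ) * ∫ z in U, V z.1 ∂μ ≤ ∫ z, V z.1 ∂μ := by
    have := setIntegral_le_integral (s := U) hVi (.of_forall fun z => h.nonneg_V z.1)
    have := setIntegral_nonneg hU (μ := μ) fun z _ => h.nonneg_V z.1
    nlinarith
  rw [vlasovEnergy_eq h.continuous_V, vlasovEnergy_eq h.continuous_V]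
  linarith

end ExternalPotentials

end Energy

section Comparison

theorem integral_norm_sq_ave_le {E : Type*} [SeminormedAddCommGroup E] {μ : Measure Phase}
    [IsProbabilityMeasure μ] {lx lp L : ℝ} (hlx : 0 < lx) (hlp : 0 < lp) {F F' : Phase → E}
    (hF : Integrable (fun z => ‖F z‖ ^ 2) (ave lx lp L μ))
    (hF' : IntegrableOn (fun z => ‖F' z‖ ^ 2) (innerRegion lx lp L) μ) {δ κ : ℝ} (hκ : 0 < κ)
    (h : ∀ z z', ‖z.1 - z'.1‖ ≤ 2 * lx → ‖z.2 - z'.2‖ ≤ 2 * lp → ‖F z - F' z'‖ ≤ δ) :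
    ∫ z, ‖F z‖ ^ 2 ∂(ave lx lp L μ)
      ≤ (1 + κ) * ∫ z in innerRegion lx lp L, ‖F' z‖ ^ 2 ∂μ + (1 + κ⁻¹) * δ ^ 2 := by
  have hc := integrable_const (μ := μ.restrict (innerRegion lx lp L)) ((1 + κ⁻¹) * δ ^ 2)
  have const_le : ∫ _ in innerRegion lx lp L, (1 + κ⁻¹) * δ ^ 2 ∂μ ≤ (1 + κ⁻¹) * δ ^ 2 := by
    rw [setIntegral_const, smul_eq_mul]
    exact mul_le_of_le_one_left (by positivity) measureReal_le_one
  rw [← integral_const_mul]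
  refine (integral_ave_le_setIntegral hlx hlp hF ((hF'.const_mul (1 + κ)).add hc)
    fun z z' hx hp => ?_).trans
      ((integral_add (hF'.const_mul _) hc).trans_le (add_le_add_right const_le _))
  have split := norm_add_sq_le_one_add_mul (F' z') (F z - F' z') hκ
  rw [add_sub_cancel] at split
  refine split.trans (add_le_add_right ?_ _)
  exact mul_le_mul_of_nonneg_left (by gcongr; exact h z z' hx hp) (by positivity)

variable {Ae : Plane → Plane} {V : Plane → ℝ} {s : ℝ} {χ : Plane → ℝ}

namespace ExternalPotentials

theorem exists_integral_V_ave_le (h : ExternalPotentials Ae V s) :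
    ∃ K, 0 < K ∧ ∀ (lx lp L κ : ℝ) (μ : Measure Phase) [IsProbabilityMeasure μ],
      0 < lx → 0 < lp → 2 * lx ≤ 1 → K * lx ≤ κ → Integrable (fun z => V z.1) (ave lx lp L μ) →
      Integrable (fun z => V z.1) μ →
      ∫ z, V z.1 ∂(ave lx lp L μ)
        ≤ (1 + κ) * ∫ z in innerRegion lx lp L, V z.1 ∂μ + κ := by
  obtain ⟨K, hK, V_sub_le⟩ := h.exists_V_sub_le
  refine ⟨K * 2, by positivity, fun lx lp L κ μ _ hlx hlp hlx1 hκ hVave hV => ?_⟩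
  have hκ0 : 0 ≤ κ := le_trans (by positivity) hκ
  have hc := integrable_const (μ := μ.restrict (innerRegion lx lp L)) κ
  have const_le : ∫ _ in innerRegion lx lp L, κ ∂μ ≤ κ := by
    rw [setIntegral_const, smul_eq_mul]
    exact mul_le_of_le_one_left hκ0 measureReal_le_one
  rw [← integral_const_mul]
  refine (integral_ave_le_setIntegral hlx hlp hVave ((hV.integrableOn.const_mul (1 + κ)).add hc)
    fun z z' hx _ => ?_).trans
      ((integral_add (hV.integrableOn.const_mul _) hc).trans_le (add_le_add_right const_le _))
  have hV₀ := h.nonneg_V z'.1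
  calc V z.1 ≤ V z'.1 + K * ‖z.1 - z'.1‖ * (1 + V z'.1) := by
        linarith [V_sub_le z.1 z'.1 (hx.trans hlx1)]
    _ ≤ V z'.1 + κ * (1 + V z'.1) := by
        gcongr
        calc K * ‖z.1 - z'.1‖ ≤ K * (2 * lx) := by gcongr
          _ ≤ κ := by linarith
    _ = (1 + κ) * V z'.1 + κ := by ring

theorem exists_norm_vectorPotential_sub_ave_le_mul_sqrt (h : ExternalPotentials Ae V s)
    (hχ : SmearingProfile χ) (β : ℝ) (M : ℝ≥0) :
    ∃ K, 0 < K ∧ ∀ (R lx lp L : ℝ) (μ : Measure Phase) [IsFiniteMeasure μ] (x x' : Plane),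
      0 < R → 0 < lx → 0 < lp → 4 * lx ≤ R → ‖x - x'‖ ≤ 2 * lx →
      ave lx lp L μ ≤ M • volume.restrict (cube L) →
      ‖vectorPotential χ R (ave lx lp L μ).fst x
          - vectorPotential χ R (μ.restrict (innerRegion lx lp L)).fst x'‖
        ≤ K * (lx / R) * √(1 + ∫ w,
          ‖mechanicalMomentum Ae β χ R (ave lx lp L μ).fst w‖ ^ 2 ∂(ave lx lp L μ)) := by
  obtain ⟨C, hC, field_sub_le⟩ := hχ.exists_norm_vectorPotential_sub_ave_le
  set B := 1 + M * (Real.pi * ∫ y : Plane, ((1 + ‖y‖) ^ 4)⁻¹)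
  have : 0 < B := add_pos_of_pos_of_nonneg one_pos (mul_nonneg M.2 (mul_nonneg Real.pi_nonneg
    (integral_nonneg fun y => by positivity)))
  refine ⟨C * B, by positivity, fun R lx lp L μ _ x x' hR hlx hlp hlxR hx ave_le => ?_⟩
  have := isFiniteMeasure_ave (L := L) (μ := μ) hlx hlp
  have hAe := h.continuous_Ae
  have hfield := hχ.continuous_vectorPotential hR (ρ := (ave lx lp L μ).fst)
  have inv_sq_le := integral_inv_add_norm_sub_sq_le_mul_sqrt (M := M) (ν := ave lx lp L μ)
    (a := fun x => Ae x + β • vectorPotential χ R (ave lx lp L μ).fst x)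
    (ave_le.trans (by gcongr; exact Measure.restrict_le_self))
    (by fun_prop) (integrable_of_le_smul_restrict_cube ave_le (by fun_prop)) hR x
  simp only [← add_assoc] at inv_sq_le
  rw [norm_sub_rev] at hx ⊢
  calc _ ≤ C * lx * ∫ w, ((R + ‖x - w.1‖) ^ 2)⁻¹ ∂(ave lx lp L μ) :=
        field_sub_le R lx lp L μ x' x hR hlx hlp hlxR hx
    _ ≤ C * lx * (B * (R⁻¹ * _)) := by gcongr
    _ = _ := by simp only [mechanicalMomentum]; ring

theorem exists_norm_mechanicalMomentum_sub_le (h : ExternalPotentials Ae V s)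
    (hχ : SmearingProfile χ) (β : ℝ) (M : ℝ≥0) :
    ∃ K, 0 < K ∧ ∀ (R lx lp L : ℝ) (μ : Measure Phase) [IsFiniteMeasure μ],
      0 < R → R ≤ 1 → 0 < lx → 0 < lp → 4 * lx ≤ R →
      ave lx lp L μ ≤ M • volume.restrict (cube L) →
      ∀ z z', ‖z.1 - z'.1‖ ≤ 2 * lx → ‖z.2 - z'.2‖ ≤ 2 * lp →
      ‖mechanicalMomentum Ae β χ R (ave lx lp L μ).fst z
          - mechanicalMomentum Ae β χ R (μ.restrict (innerRegion lx lp L)).fst z'‖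
        ≤ K * (lp + lx / R) * √(1 + ∫ w,
          ‖mechanicalMomentum Ae β χ R (ave lx lp L μ).fst w‖ ^ 2 ∂(ave lx lp L μ)) := by
  obtain ⟨A, lipschitz_Ae⟩ := h.exists_lipschitzWith_Ae
  obtain ⟨C, hC, field_sub_le⟩ := h.exists_norm_vectorPotential_sub_ave_le_mul_sqrt hχ β M
  refine ⟨2 + 2 * A + |β| * C, by positivity,
    fun R lx lp L μ _ hR hR1 hlx hlp hlxR ave_le z z' hx hp => ?_⟩
  have field_le := field_sub_le R lx lp L μ z.1 z'.1 hR hlx hlp hlxR hx ave_le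
  set S := √(1 + ∫ w, ‖mechanicalMomentum Ae β χ R (ave lx lp L μ).fst w‖ ^ 2 ∂(ave lx lp L μ))
  have one_le_S : 1 ≤ S :=
    Real.one_le_sqrt.2 (le_add_of_nonneg_right (integral_nonneg fun w => by positivity))
  have lx_le : lx ≤ lx / R := le_div_self hlx.le hR hR1
  have Ae_sub_le : ‖Ae z.1 - Ae z'.1‖ ≤ A * (2 * (lx / R)) :=
    (lipschitz_Ae.norm_sub_le _ _).trans (by gcongr; linarith)
  have eq_add : mechanicalMomentum Ae β χ R (ave lx lp L μ).fst z
      - mechanicalMomentum Ae β χ R (μ.restrict (innerRegion lx lp L)).fst z'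
      = (z.2 - z'.2) + (Ae z.1 - Ae z'.1) + β • (vectorPotential χ R (ave lx lp L μ).fst z.1
        - vectorPotential χ R (μ.restrict (innerRegion lx lp L)).fst z'.1) := by
    simp only [mechanicalMomentum, smul_sub]
    abel
  rw [eq_add]
  calc _ ≤ 2 * lp + A * (2 * (lx / R)) + |β| * (C * (lx / R) * S) := by
        refine norm_add₃_le.trans ?_
        rw [norm_smul, Real.norm_eq_abs]
        gcongr
    _ ≤ (2 * lp + A * (2 * (lx / R))) * S + |β| * (C * (lx / R) * S) := by
        gcongr
        exact le_mul_of_one_le_right (by positivity) one_le_S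
    _ = (2 * lp + (2 * A + |β| * C) * (lx / R)) * S := by ring
    _ ≤ _ := by
        gcongr
        have : 0 ≤ (2 * A + |β| * C) * lp + 2 * (lx / R) := by positivity
        linarith

theorem exists_vlasovEnergy_ave_le (h : ExternalPotentials Ae V s) (hχ : SmearingProfile χ)
    (β : ℝ) (M : ℝ≥0) :
    ∃ K, 0 < K ∧ ∀ (R lx lp L κ : ℝ) (μ : Measure Phase) [IsProbabilityMeasure μ],
      0 < R → R ≤ 1 → 0 < lx → 0 < lp → 4 * lx ≤ R → K * (lp + lx / R) ≤ κ →
      Integrable (fun z => ‖z.2‖ ^ 2) μ → Integrable (fun z => V z.1) μ →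
      ave lx lp L μ ≤ M • volume.restrict (cube L) →
      vlasovEnergy Ae V β χ R (ave lx lp L μ)
        ≤ (1 + κ) * vlasovEnergy Ae V β χ R (μ.restrict (innerRegion lx lp L))
          + (2 * κ + κ ^ 2) * (1 + vlasovEnergy Ae V β χ R (ave lx lp L μ)) := by
  obtain ⟨K₁, hK₁, momentum_sub_le⟩ := h.exists_norm_mechanicalMomentum_sub_le hχ β M
  obtain ⟨K₂, hK₂, integral_V_le⟩ := h.exists_integral_V_ave_le
  refine ⟨K₁ + K₂, by positivity, fun R lx lp L κ μ _ hR hR1 hlx hlp hlxR hκ hp hV ave_le => ?_⟩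
  have := isFiniteMeasure_ave (L := L) (μ := μ) hlx hlp
  set δ := lp + lx / R
  have : 0 < δ := by positivity
  have hκ0 : 0 < κ := hκ.trans_lt' (by positivity)
  have lx_le : lx ≤ δ := (le_div_self hlx.le hR hR1).trans (le_add_of_nonneg_left hlp.le)
  have potential_le := integral_V_le lx lp L κ μ hlx hlp (by linarith)
    (hκ.trans' (by gcongr; exact le_add_of_nonneg_left hK₁.le))
    (integrable_of_le_smul_restrict_cube ave_le (h.continuous_V.comp continuous_fst)) hV
  have kinetic_le := integral_norm_sq_ave_le hlx hlp
    (integrable_of_le_smul_restrict_cube ave_le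
      ((continuous_mechanicalMomentum h.continuous_Ae hχ hR).norm.pow 2))
    (h.integrable_norm_mechanicalMomentum_sq hχ hR hp).integrableOn hκ0
    (momentum_sub_le R lx lp L μ hR hR1 hlx hlp hlxR ave_le)
  rw [vlasovEnergy_eq h.continuous_V, vlasovEnergy_eq h.continuous_V]
  set T := ∫ z, ‖mechanicalMomentum Ae β χ R (ave lx lp L μ).fst z‖ ^ 2 ∂(ave lx lp L μ)
  set W := ∫ z, V z.1 ∂(ave lx lp L μ)
  have hT : 0 ≤ T := integral_nonneg fun z => by positivity
  have hW : 0 ≤ W := integral_nonneg fun z => h.nonneg_V _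
  have error_le : (1 + κ⁻¹) * (K₁ * δ * √(1 + T)) ^ 2 ≤ (κ + κ ^ 2) * (1 + T) :=
    calc (1 + κ⁻¹) * (K₁ * δ * √(1 + T)) ^ 2 ≤ (1 + κ⁻¹) * (κ * √(1 + T)) ^ 2 := by
          gcongr
          exact hκ.trans' (by gcongr; exact le_add_of_nonneg_right hK₂.le)
      _ = (κ + κ ^ 2) * (1 + T) := by
          rw [mul_pow, Real.sq_sqrt (by positivity)]
          field_simp
          ring
  have : 0 ≤ κ * T + (2 * κ + κ ^ 2) * W := by positivity
  linarith

end ExternalPotentials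

end Comparison

section SmallCube

theorem exists_integrable_inv_norm_le_add_one {E : Type*} [NormedAddCommGroup E] [NormedSpace ℝ E]
    [FiniteDimensional ℝ E] [MeasurableSpace E] [BorelSpace E] {μ : Measure E}
    [μ.IsAddHaarMeasure] (hE : 1 < Module.finrank ℝ E) :
    ∃ g : E → ℝ, Integrable g μ ∧ (∀ y, 0 ≤ g y) ∧ ∀ y, ‖y‖⁻¹ ≤ g y + 1 := by
  refine ⟨(Metric.ball 0 1).indicator fun y => ‖y‖⁻¹, ?_,
    fun y => Set.indicator_nonneg (fun y _ => by positivity) y, fun y => ?_⟩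
  · exact (integrable_indicator_iff measurableSet_ball).2
      (((locallyIntegrable_inv_norm hE).integrableOn_isCompact
        (isCompact_closedBall 0 1)).mono_set Metric.ball_subset_closedBall)
  · by_cases hy : y ∈ Metric.ball 0 1
    · rw [Set.indicator_of_mem hy]
      exact le_add_of_nonneg_right zero_le_one
    · rw [Set.indicator_of_notMem hy, zero_add]
      exact inv_le_one_of_one_le₀ (by simpa using hy)

theorem fst_le_of_le_smul_restrict_prod {X Y : Type*} [MeasurableSpace X] [MeasurableSpace Y]
    {μ : Measure X} {μ' : Measure Y} [SFinite μ] [SFinite μ'] {ν : Measure (X × Y)} {M : ℝ≥0∞}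
    {S : Set X} {T : Set Y} (hν : ν ≤ M • (μ.prod μ').restrict (S ×ˢ T)) :
    ν.fst ≤ (M * μ' T) • μ := by
  rw [← Measure.prod_restrict] at hν
  refine (Measure.map_mono hν measurable_fst).trans ?_
  rw [Measure.map_smul, Measure.map_fst_prod, Measure.restrict_apply_univ, smul_smul]
  gcongr
  exact Measure.restrict_le_self

variable {Ae : Plane → Plane} {V : Plane → ℝ} {s : ℝ} {χ : Plane → ℝ}

theorem SmearingProfile.exists_norm_vectorPotential_le_of_le_smul (hχ : SmearingProfile χ) :
    ∃ C, 0 < C ∧ ∀ (R : ℝ) (ρ : Measure Plane) [IsFiniteMeasure ρ] (M : ℝ≥0) (x : Plane), 0 < R →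
      ρ ≤ M • volume → ‖vectorPotential χ R ρ x‖ ≤ C * (M + ρ.real Set.univ) := by
  obtain ⟨C, hC, norm_perpGrad_le⟩ := hχ.exists_norm_perpGrad_le
  obtain ⟨g, integrable_g, g_nonneg, inv_norm_le⟩ :=
    exists_integrable_inv_norm_le_add_one (μ := volume) one_lt_finrank_plane
  have : 0 ≤ ∫ y, g y := integral_nonneg g_nonneg
  refine ⟨C * ((∫ y, g y) + 1), by positivity, fun R ρ _ M x hR hρ => ?_⟩
  have integrable_g_sub : Integrable (fun y => g (x - y)) (M • volume) :=
    (integrable_g.comp_sub_left x).smul_measure_nnreal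
  have integrable_g_sub' := integrable_g_sub.mono_measure hρ
  have integral_g_le : ∫ y, g (x - y) ∂ρ ≤ M * ∫ y, g y := by
    refine (integral_mono_measure hρ (.of_forall fun y => g_nonneg _) integrable_g_sub).trans_eq ?_
    rw [integral_smul_nnreal_measure, integral_sub_left_eq_self g volume x]
    rfl
  have ae_norm_le : ∀ᵐ y ∂ρ, ‖perpGrad χ R (x - y)‖ ≤ C * (g (x - y) + 1) := by
    refine (Measure.absolutelyContinuous_of_le hρ).ae_le (Measure.ae_smul_measure ?_ M)
    filter_upwards [Measure.ae_ne volume x] with y hy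
    have hxy : 0 < ‖x - y‖ := norm_pos_iff.2 (sub_ne_zero.2 hy.symm)
    calc ‖perpGrad χ R (x - y)‖ ≤ C / (R + ‖x - y‖) := norm_perpGrad_le R hR _
      _ ≤ C * ‖x - y‖⁻¹ := by
        rw [div_eq_mul_inv]
        gcongr
        exact le_add_of_nonneg_left hR.le
      _ ≤ C * (g (x - y) + 1) := by gcongr; exact inv_norm_le _
  calc ‖vectorPotential χ R ρ x‖ ≤ ∫ y, C * (g (x - y) + 1) ∂ρ :=
        norm_integral_le_of_norm_le ((integrable_g_sub'.add (integrable_const 1)).const_mul C)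
          ae_norm_le
    _ = C * ((∫ y, g (x - y) ∂ρ) + ρ.real Set.univ) := by
        rw [integral_const_mul, integral_add integrable_g_sub' (integrable_const 1),
          integral_const, smul_eq_mul, mul_one]
    _ ≤ C * (M * (∫ y, g y) + ρ.real Set.univ) := by gcongr
    _ ≤ C * ((∫ y, g y) + 1) * (M + ρ.real Set.univ) := by
        rw [mul_assoc]
        gcongr
        have : 0 ≤ (∫ y, g y) * ρ.real Set.univ + M := by positivity
        linarith

theorem ae_mem_cube_of_le_smul_restrict {ν : Measure Phase} {M : ℝ≥0} {L : ℝ}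
    (hν : ν ≤ M • volume.restrict (cube L)) : ∀ᵐ z ∂ν, z ∈ cube L :=
  (Measure.absolutelyContinuous_of_le hν).ae_le
    (Measure.ae_smul_measure (ae_restrict_mem (measurableSet_cube L)) _)

theorem fst_le_of_le_smul_restrict_cube {ν : Measure Phase} {M : ℝ≥0} {L L₀ : ℝ} (hL : L ≤ L₀)
    (hν : ν ≤ M • volume.restrict (cube L)) :
    ν.fst ≤ (M * (volume (Metric.closedBall (0 : Plane) (2 * L₀))).toNNReal) • volume := by
  set S := Metric.closedBall (0 : Plane) (2 * L₀)
  have cube_subset : cube L ⊆ S ×ˢ S :=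
    (cube_subset_closedBall_prod L).trans (Set.prod_mono
      (Metric.closedBall_subset_closedBall (by linarith))
      (Metric.closedBall_subset_closedBall (by linarith)))
  have hν' : ν ≤ M • ((volume : Measure Plane).prod volume).restrict (S ×ˢ S) :=
    hν.trans (by rw [← Measure.volume_eq_prod]; gcongr)
  rw [ENNReal.smul_def] at hν' ⊢
  rw [ENNReal.coe_mul, ENNReal.coe_toNNReal measure_closedBall_lt_top.ne]
  exact fst_le_of_le_smul_restrict_prod hν'

theorem ExternalPotentials.exists_vlasovEnergy_le_mul_measureReal_univ
    (h : ExternalPotentials Ae V s) (hχ : SmearingProfile χ) (β L₀ : ℝ) (M : ℝ≥0) :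
    ∃ K, 0 < K ∧ ∀ (R L : ℝ) (ν : Measure Phase) [IsFiniteMeasure ν], 0 < R → L ≤ L₀ →
      ν.real Set.univ ≤ 1 → ν ≤ M • volume.restrict (cube L) →
      vlasovEnergy Ae V β χ R ν ≤ K * ν.real Set.univ := by
  obtain ⟨A, norm_Ae_le⟩ := h.bounded_Ae
  obtain ⟨C, hC, field_le⟩ := hχ.exists_norm_vectorPotential_le_of_le_smul
  obtain ⟨W, V_le⟩ := (isCompact_closedBall (0 : Plane) (2 * L₀)).exists_bound_of_continuousOn
    h.continuous_V.continuousOn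
  set M' : ℝ≥0 := M * (volume (Metric.closedBall (0 : Plane) (2 * L₀))).toNNReal
  set P := 2 * L₀ + A + |β| * (C * (M' + 1)) with hP
  refine ⟨P ^ 2 + |W| + 1, by positivity, fun R L ν _ hR hL hν1 hν => ?_⟩
  have closedBall_subset : Metric.closedBall (0 : Plane) (2 * L) ⊆ Metric.closedBall 0 (2 * L₀) :=
    Metric.closedBall_subset_closedBall (by linarith)
  have integrable_momentum : Integrable (fun z => ‖mechanicalMomentum Ae β χ R ν.fst z‖ ^ 2) ν :=
    integrable_of_le_smul_restrict_cube hν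
      ((continuous_mechanicalMomentum h.continuous_Ae hχ hR).norm.pow 2)
  have integrable_V : Integrable (fun z => V z.1) ν :=
    integrable_of_le_smul_restrict_cube hν (h.continuous_V.comp continuous_fst)
  rw [vlasovEnergy_eq h.continuous_V, ← integral_add integrable_momentum integrable_V]
  refine (integral_mono_ae (integrable_momentum.add integrable_V)
    (integrable_const (P ^ 2 + |W| + 1)) ?_).trans_eq (by
      rw [integral_const, smul_eq_mul, mul_comm])
  filter_upwards [ae_mem_cube_of_le_smul_restrict hν] with z hz
  obtain ⟨hx, hp⟩ := cube_subset_closedBall_prod L hz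
  have momentum_le : ‖mechanicalMomentum Ae β χ R ν.fst z‖ ≤ P := by
    refine norm_add₃_le.trans ?_
    rw [norm_smul, Real.norm_eq_abs]
    have norm_p_le := mem_closedBall_zero_iff.1 (closedBall_subset hp)
    have field_z_le := field_le R ν.fst M' z.1 hR (fst_le_of_le_smul_restrict_cube hL hν)
    rw [measureReal_def, Measure.fst_univ, ← measureReal_def] at field_z_le
    rw [hP]
    gcongr
    · exact norm_Ae_le _
    · exact field_z_le.trans (by gcongr)
  have V_z_le : V z.1 ≤ |W| :=
    (le_abs_self _).trans ((V_le z.1 (closedBall_subset hx)).trans (le_abs_self W))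
  have : ‖mechanicalMomentum Ae β χ R ν.fst z‖ ^ 2 ≤ P ^ 2 := by gcongr
  simp only [Pi.add_apply]
  linarith

theorem measureReal_univ_le_of_le_smul_restrict_cube {ν : Measure Phase} {M : ℝ≥0} {L t : ℝ}
    (hν : ν ≤ M • volume.restrict (cube L)) (ht : 0 < t) :
    ν.real Set.univ ≤ t⁻¹ * ∫ z, ‖z.2‖ ^ 2 ∂ν
      + M * (Real.pi * t * volume.real (Metric.closedBall (0 : Plane) (2 * L))) := by
  have hν' : ν ≤ M • (volume.restrict (Metric.closedBall (0 : Plane) (2 * L))).prod volume := by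
    rw [← Measure.restrict_univ (μ := (volume : Measure Plane)), Measure.restrict_restrict
      measurableSet_closedBall, Set.inter_univ, Measure.prod_restrict, ← Measure.volume_eq_prod]
    refine hν.trans ?_
    gcongr
    exact (cube_subset_closedBall_prod L).trans (Set.prod_mono_right (Set.subset_univ _))
  have bathtub := integral_comp_fst_le_of_le_smul_prod hν' (a := fun _ => 0) (G := fun _ => 1)
    measurable_const measurable_const (fun _ => zero_le_one) ht
    (by simpa only [add_zero] using integrable_of_le_smul_restrict_cube hν (by fun_prop))
    (integrableOn_const measure_closedBall_lt_top.ne)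
  simpa using bathtub

theorem inv_sqrt_add_mul_le {R lp : ℝ} (hR : 0 < R) (hlp : 0 < lp) (D : ℝ) :
    (√R + lp)⁻¹ * (2 * D + 8 * lp ^ 2) ≤ √R + √R * (D ^ 2 / R ^ 2) + 8 * lp := by
  have sqrt_sq : √R ^ 2 = R := Real.sq_sqrt hR.le
  have two_mul_le : 2 * D ≤ R + D ^ 2 / R := by
    have := div_nonneg (sq_nonneg (D - R)) hR.le
    have : (D - R) ^ 2 / R = D ^ 2 / R - 2 * D + R := by field_simp; ring
    linarith
  have mul_eq : √R * (√R + √R * (D ^ 2 / R ^ 2)) = R + D ^ 2 / R := by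
    calc √R * (√R + √R * (D ^ 2 / R ^ 2)) = √R ^ 2 * (1 + D ^ 2 / R ^ 2) := by ring
      _ = R + D ^ 2 / R := by rw [sqrt_sq]; field_simp
  rw [inv_mul_le_iff₀ (by positivity)]
  have : 0 ≤ lp * (√R + √R * (D ^ 2 / R ^ 2)) + 8 * (√R * lp) := by positivity
  linarith

theorem ExternalPotentials.exists_vlasovEnergy_ave_le_of_le (h : ExternalPotentials Ae V s)
    (hχ : SmearingProfile χ) (β L₀ : ℝ) (M : ℝ≥0) :
    ∃ K, 0 < K ∧ ∀ (R lx lp L D : ℝ) (μ : Measure Phase) [IsProbabilityMeasure μ],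
      0 < R → 0 < lx → 0 < lp → L ≤ L₀ → Integrable (fun z => ‖z.2‖ ^ 2) μ →
      ∫ z, ‖z.2‖ ^ 2 ∂μ ≤ D → ave lx lp L μ ≤ M • volume.restrict (cube L) →
      vlasovEnergy Ae V β χ R (ave lx lp L μ) ≤ K * (√R + lp + √R * (D ^ 2 / R ^ 2)) := by
  obtain ⟨K, hK, energy_le⟩ := h.exists_vlasovEnergy_le_mul_measureReal_univ hχ β L₀ M
  set B := M * (Real.pi * volume.real (Metric.closedBall (0 : Plane) (2 * L₀))) with hB
  have : 0 ≤ B := by positivity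
  refine ⟨K * (9 + B), by positivity, fun R lx lp L D μ _ hR hlx hlp hL hp hD ave_le => ?_⟩
  have := isFiniteMeasure_ave (L := L) (μ := μ) hlx hlp
  have mass_le_one : (ave lx lp L μ).real Set.univ ≤ 1 := by
    rw [measureReal_def, ave_univ hlx hlp]
    exact measureReal_le_one
  have mass_le := measureReal_univ_le_of_le_smul_restrict_cube ave_le
    (t := √R + lp) (by positivity)
  have second_moment_le : ∫ z, ‖z.2‖ ^ 2 ∂(ave lx lp L μ) ≤ 2 * D + 8 * lp ^ 2 := by
    have ave_moment_le := integral_norm_sq_ave_le (κ := 1) hlx hlp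
      (integrable_of_le_smul_restrict_cube ave_le (by fun_prop)) hp.integrableOn one_pos
      fun z z' _ h => h
    have inner_moment_le := setIntegral_le_integral (s := innerRegion lx lp L) hp
      (.of_forall fun z => sq_nonneg ‖z.2‖)
    norm_num at ave_moment_le
    linarith
  have volume_le : volume.real (Metric.closedBall (0 : Plane) (2 * L))
      ≤ volume.real (Metric.closedBall (0 : Plane) (2 * L₀)) :=
    measureReal_mono (Metric.closedBall_subset_closedBall (by linarith))
      measure_closedBall_lt_top.ne
  calc vlasovEnergy Ae V β χ R (ave lx lp L μ) ≤ K * (ave lx lp L μ).real Set.univ :=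
        energy_le R L _ hR hL mass_le_one ave_le
    _ ≤ K * ((√R + √R * (D ^ 2 / R ^ 2) + 8 * lp) + B * (√R + lp)) := by
        gcongr
        refine mass_le.trans (add_le_add ?_ ?_)
        · refine le_trans ?_ (inv_sqrt_add_mul_le hR hlp D)
          gcongr
        · rw [hB, mul_assoc (M : ℝ), mul_right_comm]
          gcongr
    _ ≤ _ := by
        rw [mul_assoc K]
        refine mul_le_mul_of_nonneg_left ?_ hK.le
        have : 0 ≤ 8 * √R + lp + (8 + B) * (√R * (D ^ 2 / R ^ 2)) := by positivity
        linarith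

end SmallCube
section Assembly

variable {Ae : Plane → Plane} {V : Plane → ℝ} {s : ℝ} {χ : Plane → ℝ}

theorem min_pow_four_rpow_two_mul {L : ℝ} (hL : 0 < L) (s : ℝ) :
    min (L ^ 4) (L ^ (2 * s)) = min (L ^ 2) (L ^ s) ^ 2 := by
  have monotoneOn_sq : MonotoneOn (fun t : ℝ => t ^ 2) (Set.Ici 0) :=
    fun a ha b _ hab => pow_le_pow_left₀ ha hab 2
  refine Eq.trans ?_ (monotoneOn_sq.map_min (sq_nonneg L) (Real.rpow_nonneg hL.le s)).symm
  rw [← pow_mul, mul_comm 2 s, Real.rpow_mul hL.le, Real.rpow_two]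

theorem mul_measureReal_compl_le_integral {X : Type*} [MeasurableSpace X] {μ : Measure X}
    [IsFiniteMeasure μ] {f : X → ℝ} {U : Set X} {c : ℝ} (hU : MeasurableSet U)
    (hf : Integrable f μ) (hf₀ : ∀ x, 0 ≤ f x) (hc : ∀ x ∉ U, c ≤ f x) :
    c * μ.real Uᶜ ≤ ∫ x, f x ∂μ :=
  calc c * μ.real Uᶜ = ∫ _ in Uᶜ, c ∂μ := by rw [setIntegral_const, smul_eq_mul, mul_comm]
    _ ≤ ∫ x in Uᶜ, f x ∂μ :=
        setIntegral_mono_on (integrable_const c).integrableOn hf.integrableOn hU.compl hc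
    _ ≤ ∫ x, f x ∂μ := setIntegral_le_integral hf (.of_forall hf₀)

theorem one_sub_four_mul_mul_le {E E' κ : ℝ} (hE : 0 ≤ E) (hκ : 0 ≤ κ) (hκ₁ : κ ≤ 1)
    (h : E ≤ (1 + κ) * E' + (2 * κ + κ ^ 2) * (1 + E)) : (1 - 4 * κ) * E ≤ E' + 3 * κ := by
  have sq_le : κ ^ 2 ≤ κ := by nlinarith
  have : κ ^ 2 * (1 + E) ≤ κ * (1 + E) := by gcongr
  refine le_of_mul_le_mul_left ?_ (by linarith : 0 < 1 + κ)
  have : 0 ≤ 4 * κ ^ 2 * E + 3 * κ ^ 2 := by positivity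
  linarith

theorem one_sub_mul_one_sub_min_one_mul_sub_sub_le {E F θ σ e : ℝ} (hE : 0 ≤ E) (hF : 0 ≤ F)
    (hθ : 0 ≤ θ) (he : 0 ≤ e) (h : σ ≤ 1 → θ ≤ 1 → (1 - σ) * (1 - θ) * E - θ - e ≤ F) :
    (1 - σ) * (1 - min 1 θ) * E - θ - e ≤ F := by
  rcases lt_or_ge 1 θ with hθ₁ | hθ₁
  · rw [min_eq_left hθ₁.le]
    linarith
  · rw [min_eq_right hθ₁]
    rcases lt_or_ge 1 σ with hσ₁ | hσ₁
    · have := mul_nonneg (mul_nonneg (sub_nonneg.2 hσ₁.le) (sub_nonneg.2 hθ₁)) hE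
      linarith
    · exact h hσ₁ hθ₁

namespace ExternalPotentials

theorem exists_measureReal_compl_innerRegion_sq_le (h : ExternalPotentials Ae V s) :
    ∃ L₀ C, 0 < L₀ ∧ 0 < C ∧ ∀ (L lx lp D : ℝ) (μ : Measure Phase) [IsFiniteMeasure μ],
      L₀ ≤ L → 0 < lx → lx ≤ 1 → 0 < lp → lp ≤ 1 →
      Integrable (fun z => ‖z.2‖ ^ 2 + V z.1) μ → ∫ z, (‖z.2‖ ^ 2 + V z.1) ∂μ ≤ D →
      μ.real (innerRegion lx lp L)ᶜ ^ 2 ≤ C * (D ^ 2 / min (L ^ 4) (L ^ (2 * s))) := by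
  obtain ⟨L₀, c, hL₀, hc, le_of_notMem⟩ := h.exists_le_of_notMem_innerRegion
  refine ⟨L₀, (c ^ 2)⁻¹, by positivity, by positivity,
    fun L lx lp D μ _ hL hlx hlx₁ hlp hlp₁ hi hD => ?_⟩
  have hL' : 0 < L := by linarith
  have chebyshev : c * min (L ^ 2) (L ^ s) * μ.real (innerRegion lx lp L)ᶜ ≤ D :=
    (mul_measureReal_compl_le_integral (measurableSet_innerRegion lx lp L) hi
      (fun z => add_nonneg (sq_nonneg _) (h.nonneg_V _))
      (le_of_notMem L lx lp hL hlx hlx₁ hlp hlp₁)).trans hD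
  rw [min_pow_four_rpow_two_mul hL', ← div_eq_inv_mul, div_div, ← mul_pow, mul_comm _ c, ← div_pow]
  gcongr
  rwa [le_div_iff₀' (by positivity)]

theorem exists_one_sub_mul_vlasovEnergy_ave_le_of_large_cube (h : ExternalPotentials Ae V s)
    (hχ : SmearingProfile χ) (β : ℝ) :
    ∃ L₀ C, 0 < L₀ ∧ 0 < C ∧ ∀ M : ℝ≥0, ∃ K, 0 < K ∧
      ∀ (R lx lp L σ D θ : ℝ) (μ : Measure Phase) [IsProbabilityMeasure μ],
        0 < R → 0 < lx → 0 < lp → L₀ ≤ L → 0 < σ → σ ≤ 1 →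
        K * (√R + lx / R + lp) ≤ θ → θ ≤ 1 →
        Integrable (fun z => ‖z.2‖ ^ 2) μ → Integrable (fun z => V z.1) μ →
        ∫ z, (‖z.2‖ ^ 2 + V z.1) ∂μ ≤ D → ave lx lp L μ ≤ M • volume.restrict (cube L) →
        (1 - σ) * (1 - θ) * vlasovEnergy Ae V β χ R (ave lx lp L μ) - θ
            - C * (D ^ 2 / (σ * R ^ 2 * min (L ^ 4) (L ^ (2 * s))))
          ≤ vlasovEnergy Ae V β χ R μ := by
  obtain ⟨L₀, C₀, hL₀, hC₀, outer_mass_le⟩ := h.exists_measureReal_compl_innerRegion_sq_le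
  obtain ⟨C₁, hC₁, localize⟩ := h.exists_one_sub_mul_vlasovEnergy_restrict_le hχ β
  refine ⟨L₀, C₁ * C₀, hL₀, by positivity, fun M => ?_⟩
  obtain ⟨K, hK, average⟩ := h.exists_vlasovEnergy_ave_le hχ β M
  refine ⟨4 * (K + 1), by positivity,
    fun R lx lp L σ D θ μ _ hR hlx hlp hL hσ hσ₁ hθ hθ₁ hp hV hD ave_le => ?_⟩
  have : 0 < lx / R := by positivity
  have : 0 < √R := by positivity
  have : 0 ≤ K * (√R + lx / R + lp) := by positivity
  have : 0 ≤ K * √R := by positivity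
  have sqrt_le_one : √R ≤ 1 := by linarith
  have hR₁ : R ≤ 1 := Real.sqrt_le_one.1 sqrt_le_one
  have hlxR : 4 * lx ≤ R := by
    rw [← div_le_one hR, mul_div_assoc]
    linarith
  have average' := one_sub_four_mul_mul_le (κ := θ / 4) (h.vlasovEnergy_nonneg _)
    (by linarith) (by linarith)
    (average R lx lp L (θ / 4) μ hR hR₁ hlx hlp hlxR (by linarith) hp hV ave_le)
  have outer_mass_le' := outer_mass_le L lx lp D μ hL hlx (by linarith) hlp (by linarith)
    (hp.add hV) hD
  have := localize R σ μ (innerRegion lx lp L) hR hσ (measurableSet_innerRegion lx lp L) hp hV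
  have error_le : C₁ * (μ.real (innerRegion lx lp L)ᶜ ^ 2 / (σ * R ^ 2))
      ≤ C₁ * C₀ * (D ^ 2 / (σ * R ^ 2 * min (L ^ 4) (L ^ (2 * s)))) :=
    calc _ ≤ C₁ * (C₀ * (D ^ 2 / min (L ^ 4) (L ^ (2 * s))) / (σ * R ^ 2)) := by gcongr
      _ = _ := by rw [mul_div_assoc, div_div, mul_comm (σ * R ^ 2), mul_assoc]
  have := mul_le_mul_of_nonneg_left average' (sub_nonneg.2 hσ₁)
  have : 0 ≤ σ * θ := mul_nonneg hσ.le (by linarith)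
  linarith

theorem exists_vlasovEnergy_ave_le_of_small_cube (h : ExternalPotentials Ae V s)
    (hχ : SmearingProfile χ) (β L₀ : ℝ) (M : ℝ≥0) :
    ∃ K, 0 < K ∧ ∀ (R lx lp L σ D θ : ℝ) (μ : Measure Phase) [IsProbabilityMeasure μ],
      0 < R → 0 < lx → 0 < lp → 0 < L → L ≤ L₀ → 0 < σ → σ ≤ 1 →
      K * (√R + lp) ≤ θ → θ ≤ 1 →
      Integrable (fun z => ‖z.2‖ ^ 2) μ → ∫ z, ‖z.2‖ ^ 2 ∂μ ≤ D →
      ave lx lp L μ ≤ M • volume.restrict (cube L) →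
      vlasovEnergy Ae V β χ R (ave lx lp L μ)
        ≤ θ + L₀ ^ 4 * (D ^ 2 / (σ * R ^ 2 * min (L ^ 4) (L ^ (2 * s)))) := by
  obtain ⟨K, hK, energy_le⟩ := h.exists_vlasovEnergy_ave_le_of_le hχ β L₀ M
  refine ⟨K, hK, fun R lx lp L σ D θ μ _ hR hlx hlp hL hL₀ hσ hσ₁ hθ hθ₁ hp hD ave_le => ?_⟩
  have K_mul_sqrt_le : K * √R ≤ 1 := by
    have : 0 ≤ K * lp := by positivity
    linarith
  calc _ ≤ K * (√R + lp) + K * √R * (D ^ 2 / R ^ 2) :=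
        (energy_le R lx lp L D μ hR hlx hlp hL₀ hp hD ave_le).trans_eq (by ring)
    _ ≤ θ + 1 * (D ^ 2 / R ^ 2) := by gcongr
    _ = θ + L₀ ^ 4 * (D ^ 2 / (1 * R ^ 2 * L₀ ^ 4)) := by
        have : 0 < L₀ := hL.trans_le hL₀
        field_simp
    _ ≤ _ := by
        gcongr
        exact (min_le_left _ _).trans (by gcongr)

theorem exists_one_sub_mul_vlasovEnergy_ave_le (h : ExternalPotentials Ae V s)
    (hχ : SmearingProfile χ) (β : ℝ) :
    ∃ C, 0 < C ∧ ∀ M : ℝ≥0, ∃ K, 0 < K ∧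
      ∀ (R lx lp L σ D : ℝ) (μ : Measure Phase) [IsProbabilityMeasure μ],
        0 < R → 0 < lx → 0 < lp → 0 < L → 0 < σ →
        (∀ m, box lx lp m ⊆ cube L → μ (box lx lp m) ≤ M * volume (box lx lp m)) →
        Integrable (fun z => ‖z.2‖ ^ 2) μ → Integrable (fun z => V z.1) μ →
        ∫ z, (‖z.2‖ ^ 2 + V z.1) ∂μ ≤ D →
        (1 - σ) * (1 - min 1 (K * (√R + lx / R + lp))) *
              vlasovEnergy Ae V β χ R (ave lx lp L μ)
            - K * (√R + lx / R + lp)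
            - C * (D ^ 2 / (σ * R ^ 2 * min (L ^ 4) (L ^ (2 * s))))
          ≤ vlasovEnergy Ae V β χ R μ := by
  obtain ⟨L₀, C, hL₀, hC, large_cube⟩ :=
    h.exists_one_sub_mul_vlasovEnergy_ave_le_of_large_cube hχ β
  refine ⟨C + L₀ ^ 4, by positivity, fun M => ?_⟩
  obtain ⟨K₁, hK₁, large_cube⟩ := large_cube M
  obtain ⟨K₂, hK₂, small_cube⟩ := h.exists_vlasovEnergy_ave_le_of_small_cube hχ β L₀ M
  refine ⟨K₁ + K₂, by positivity, fun R lx lp L σ D μ _ hR hlx hlp hL hσ box_le hp hV hD => ?_⟩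
  have ave_le := ave_le_of_box_le hlx hlp box_le
  set E := vlasovEnergy Ae V β χ R (ave lx lp L μ)
  set δ := √R + lx / R + lp
  set error := D ^ 2 / (σ * R ^ 2 * min (L ^ 4) (L ^ (2 * s)))
  have E_nonneg : 0 ≤ E := h.vlasovEnergy_nonneg _
  have energy_nonneg : 0 ≤ vlasovEnergy Ae V β χ R μ := h.vlasovEnergy_nonneg _
  have δ_nonneg : 0 ≤ δ := by positivity
  have large_error_nonneg : 0 ≤ C * error := by positivity
  have small_error_nonneg : 0 ≤ L₀ ^ 4 * error := by positivity
  refine one_sub_mul_one_sub_min_one_mul_sub_sub_le E_nonneg energy_nonneg (by positivity)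
    (by positivity) fun hσ₁ hθ₁ => ?_
  rcases le_or_gt L₀ L with hL₀L | hLL₀
  · have := large_cube R lx lp L σ D _ μ hR hlx hlp hL₀L hσ hσ₁
      (mul_le_mul_of_nonneg_right (le_add_of_nonneg_right hK₂.le) δ_nonneg) hθ₁ hp hV hD ave_le
    linarith
  · have K₂_mul_le : K₂ * (√R + lp) ≤ (K₁ + K₂) * δ := by
      have := div_nonneg hlx.le hR.le
      exact mul_le_mul (by linarith) (by linarith) (by positivity) (by positivity)
    have hpD : ∫ z, ‖z.2‖ ^ 2 ∂μ ≤ D :=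
      (integral_mono hp (hp.add hV) fun z => le_add_of_nonneg_right (h.nonneg_V _)).trans hD
    have := small_cube R lx lp L σ D _ μ hR hlx hlp hL hLL₀.le hσ hσ₁ K₂_mul_le hθ₁ hp hpD ave_le
    have : (1 - σ) * (1 - (K₁ + K₂) * δ) * E ≤ E :=
      mul_le_of_le_one_left E_nonneg
        (mul_le_one₀ (by linarith) (by linarith) (sub_le_self 1 (by positivity)))
    linarith

end ExternalPotentials

section Emp

variable {N : ℕ} (Z : Fin N → Phase)

theorem isProbabilityMeasure_emp (hN : 1 ≤ N) : IsProbabilityMeasure (emp Z) := by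
  constructor
  simp only [emp, Measure.smul_apply, Measure.finsetSum_apply, measure_univ, smul_eq_mul,
    Finset.sum_const, Finset.card_univ, Fintype.card_fin, nsmul_eq_mul, mul_one]
  exact ENNReal.inv_mul_cancel (by simp; omega) (by simp)

theorem integrable_emp (hN : 1 ≤ N) {E : Type*} [NormedAddCommGroup E] (f : Phase → E) :
    Integrable f (emp Z) := by
  refine Integrable.smul_measure ?_ (by simp; omega)
  rw [integrable_finsetSum_measure]
  exact fun i _ => integrable_dirac (by simp)

theorem emp_box_le_of_notMem_pauliViolating {lx lp L ε : ℝ} {m : (Fin 2 → ℤ) × (Fin 2 → ℤ)}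
    (hN : 1 ≤ N) (hZ : emp Z ∉ pauliViolating N lx lp L ε) (hm : box lx lp m ⊆ cube L) :
    emp Z (box lx lp m)
      ≤ ((1 + ε) / (2 * Real.pi) ^ 2).toNNReal * volume (box lx lp m) := by
  have := isProbabilityMeasure_emp Z hN
  have real_lt : (emp Z).real (box lx lp m)
      < (1 + ε) / (2 * Real.pi) ^ 2 * volume.real (box lx lp m) := by
    contrapose! hZ
    exact ⟨⟨Z, rfl⟩, m, hm, hZ⟩
  have volume_ne_top : volume (box lx lp m) ≠ ⊤ :=
    ((measure_mono hm).trans_lt (volume_cube_lt_top L)).ne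
  rw [← ofReal_measureReal, ← ofReal_measureReal volume_ne_top, ← ENNReal.ofReal,
    ← ENNReal.ofReal_mul' measureReal_nonneg]
  exact ENNReal.ofReal_le_ofReal real_lt.le

end Emp

end Assembly

end Anyons

end
theorem mainTheorem6_general
    (Ae : Anyons.Plane → Anyons.Plane) (V : Anyons.Plane → ℝ) (s : ℝ)
    (hext : Anyons.ExternalPotentials Ae V s)
    (χ : Anyons.Plane → ℝ) (hχ : Anyons.SmearingProfile χ) (β : ℝ) :
    ∃ C : ℝ, 0 < C ∧
      ∀ (M : ℝ≥0) (R lx lp : ℕ → ℝ), Tendsto R atTop (𝓝 0) →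
        Tendsto (fun N => lx N / R N) atTop (𝓝 0) → Tendsto lp atTop (𝓝 0) →
        ∃ o₁ o₂ : ℕ → ℝ, Tendsto o₁ atTop (𝓝 0) ∧ Tendsto o₂ atTop (𝓝 0) ∧
          ∀ N : ℕ, 0 < R N → 0 < lx N → 0 < lp N → ∀ L : ℝ, 0 < L →
            ∀ (D : ℝ) (μ : Measure Anyons.Phase) [IsProbabilityMeasure μ],
              (∀ m, Anyons.box (lx N) (lp N) m ⊆ Anyons.cube L →
                μ (Anyons.box (lx N) (lp N) m) ≤ M * volume (Anyons.box (lx N) (lp N) m)) →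
              Integrable (fun z => ‖z.2‖ ^ 2) μ → Integrable (fun z => V z.1) μ →
              ∫ z, (‖z.2‖ ^ 2 + V z.1) ∂μ ≤ D →
              ∀ σ : ℝ, 0 < σ →
                (1 - σ) * (1 - o₁ N) *
                    Anyons.vlasovEnergy Ae V β χ (R N) (Anyons.ave (lx N) (lp N) L μ)
                  - o₂ N - C * (D ^ 2 / (σ * R N ^ 2 * min (L ^ 4) (L ^ (2 * s))))
                ≤ Anyons.vlasovEnergy Ae V β χ (R N) μ := by
  obtain ⟨C, hC, energy_le⟩ := hext.exists_one_sub_mul_vlasovEnergy_ave_le hχ β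
  refine ⟨C, hC, fun M R lx lp hR hlxR hlp => ?_⟩
  obtain ⟨K, -, energy_le⟩ := energy_le M
  have rate_tendsto : Tendsto (fun N => K * (√(R N) + lx N / R N + lp N)) atTop (𝓝 0) := by
    simpa using ((hR.sqrt.add hlxR).add hlp).const_mul K
  have min_rate_tendsto :
      Tendsto (fun N => min 1 (K * (√(R N) + lx N / R N + lp N))) atTop (𝓝 0) := by
    simpa using (tendsto_const_nhds (x := (1 : ℝ))).min rate_tendsto
  exact ⟨_, _, min_rate_tendsto, rate_tendsto,
    fun N hRN hlxN hlpN L hL D μ _ box_le hp hV hD σ hσ =>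
      energy_le _ _ _ L σ D μ hRN hlxN hlpN hL hσ box_le hp hV hD⟩

theorem mainTheorem6
    (Ae : Anyons.Plane → Anyons.Plane) (V : Anyons.Plane → ℝ) (s : ℝ)
    (hext : Anyons.ExternalPotentials Ae V s)
    (χ : Anyons.Plane → ℝ) (hχ : Anyons.SmearingProfile χ) (β : ℝ) :
    ∃ C : ℝ, 0 < C ∧
      ∀ (b ε : ℝ) (R lx lp : ℕ → ℝ), 0 < b → b < 1 → 0 < ε →
        (∀ N, 1 ≤ N → 0 < R N ∧ 0 < lx N ∧ 0 < lp N) →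
        (∀ N, 1 ≤ N → lx N ^ 2 * lp N ^ 2 = (N : ℝ) ^ (-b)) →
        Tendsto R atTop (𝓝 0) →
        Tendsto (fun N => lx N / R N) atTop (𝓝 0) →
        Tendsto lp atTop (𝓝 0) →
        ∃ o₁ o₂ : ℕ → ℝ, Tendsto o₁ atTop (𝓝 0) ∧ Tendsto o₂ atTop (𝓝 0) ∧
          ∀ N : ℕ, 1 ≤ N → ∀ L : ℝ, 0 < L → ∀ (D : ℝ) (Z : Fin N → Anyons.Phase),
            Anyons.emp Z ∉ Anyons.pauliViolating N (lx N) (lp N) L ε →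
            ∫ z, (‖z.2‖ ^ 2 + V z.1) ∂(Anyons.emp Z) ≤ D →
            ∀ σ : ℝ, 0 < σ →
              (1 - σ) * (1 - o₁ N) *
                  Anyons.vlasovEnergy Ae V β χ (R N)
                    (Anyons.ave (lx N) (lp N) L (Anyons.emp Z))
                - o₂ N - C * (D ^ 2 / (σ * R N ^ 2 * min (L ^ 4) (L ^ (2 * s))))
              ≤ Anyons.vlasovEnergy Ae V β χ (R N) (Anyons.emp Z) := by
  obtain ⟨C, hC, energy_le⟩ := mainTheorem6_general Ae V s hext χ hχ β
  refine ⟨C, hC, fun b ε R lx lp _ _ _ hpos _ hR hlxR hlp => ?_⟩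
  obtain ⟨o₁, o₂, ho₁, ho₂, energy_le⟩ :=
    energy_le ((1 + ε) / (2 * Real.pi) ^ 2).toNNReal R lx lp hR hlxR hlp
  refine ⟨o₁, o₂, ho₁, ho₂, fun N hN L hL D Z hZ hD σ hσ => ?_⟩
  obtain ⟨hRN, hlxN, hlpN⟩ := hpos N hN
  have := Anyons.isProbabilityMeasure_emp Z hN
  exact energy_le N hRN hlxN hlpN L hL D (Anyons.emp Z)
    (fun m => Anyons.emp_box_le_of_notMem_pauliViolating Z hN hZ) (Anyons.integrable_emp Z hN _)
    (Anyons.integrable_emp Z hN _) hD σ hσ
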